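/- **Setting.** Let $N\ge 2$, $\alpha\in(0,1)$, $\Delta>0$ and $L\in\mathbb N$. The vertices $v_i$, $i\in\mathbb Z/N$, of a ring carry values $q_i\in\{0,\Delta,\dots,(L-1)\Delta\}$ with $q_i\ge\Delta$ and $\sum_i q_i=L\Delta$. At each step one edge $(v_i,v_{i+1})$ is active; the next active edge is $(v_{i-1},v_i)$. The active nodes interact by $$q_i'=\mathcal Q\!\left(\tfrac{1+\alpha}{2}q_i+\tfrac{1-\alpha}{2}q_{i+1}\right),\qquad q_{i+1}'=q_i+q_{i+1}-q_i',$$ where $\mathcal Q(x)$ is the element of $\{0,\Delta,\dots,(L-1)\Delta\}$ nearest to $x+\mathbf v$, with $\mathbf v$ uniform on $(-\Delta/2,\Delta/2)$, independent at different steps. The interaction is a compression if $|q_i'-q_{i+1}'|<|q_i-q_{i+1}|$. A TDM state is one in which, writing $L=\ell N+r$ with $0\le r<N$, exactly $r$ nodes have value $(\ell+1)\Delta$ and the others have value $\ell\Delta$. For a non-TDM state $q$ and an initial active edge $e$, let $\tau(q,e)$ be the expected number of interactions up to and including the first compression. Put $\bar T_{\max}(L,e)=\sup_q \tau(q,e)$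 over all non-TDM states $q$ (the supremum over the empty set being $0$), and let $\tau_{\mathrm{av}}(q,e)$ be the average of $\tau(q\circ\sigma,e)$ over all $N!$ permutations $\sigma$ of the nodes. A two-outlier configuration has the value $(\ell+1)\Delta$ at one node, $(\ell-1)\Delta$ at another one, and $\ell\Delta$ at all others (so $L=\ell N$). Let $$\bar T=\frac{N^4(\alpha+1)^2+N^3(\alpha+1)^2+12N^2(\alpha-1)^2-24N(\alpha-1)(2\alpha-1)+24(\alpha-1)^2}{24N(1-\alpha)(1+\alpha)},\qquad g(\alpha)=\frac{\alpha+1}{24(1-\alpha)}.$$ **Theorem.** 1. Let $L=\ell N$ with $\ell\ge2$, and let $e$ be any initial active edge. The average of $\tau(q,e)$ over the $N(N-1)$ two-outlier configurations $q$ equals $\bar T$ exactly. This is the worst case: the maximum of $\tau_{\mathrm{av}}(q,e)$ over all non-TDM states $q$ is attained and equals $\bar T$, and $\bar T_{\max}(\ell N,e)=\tau(q,e)$ for some two-outlier configuration $q$, which is itself a non-TDM state. 2. For arbitrary $L$ and $e$, $\tau_{\mathrm{av}}(q,e)\le\bar T$ for every non-TDM state $q$, and $\bar T_{\max}(L,e)\le\bar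 T_{\max}(\ell N,e)$ for every $\ell\ge2$. 3. There is an absolute constant $C>0$ such that $\bar T_{\max}(L,e)\le C\,g(\alpha)N^3$ for all $N\ge2$, $\alpha\in(0,1)$, $\Delta>0$, $L$ and $e$; and for every fixed $\alpha\in(0,1)$, $\bar T\sim g(\alpha)N^3$ as $N\to\infty$. -/

import Mathlib

open MeasureTheory ProbabilityTheory Filter Asymptotics
open scoped ENNReal

noncomputable section

namespace DitheredDesync

/-- The discrete set of counter values `{0, Δ, …, (L - 1) Δ}`. -/
def slots (Δ : ℝ) (L : ℕ) : Set ℝ := {τ | ∃ j : ℕ, j < L ∧ τ = j * Δ}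

/-- The element of `slots Δ L` nearest to `y` (of two nearest ones, the larger). -/
def nearestSlot (Δ : ℝ) (L : ℕ) (y : ℝ) : ℝ :=
  ((max 0 (min ((L : ℤ) - 1) (round (y / Δ))) : ℤ) : ℝ) * Δ

/-- The law of an i.i.d. sequence of dither variables, each uniform on `(-Δ/2, Δ/2)`. -/
def ditherLaw (Δ : ℝ) : Measure (ℕ → ℝ) :=
  Measure.infinitePi fun _ : ℕ => ProbabilityTheory.cond (volume : Measure ℝ) (Set.Ioo (-(Δ / 2)) (Δ / 2))

/-- One interaction across the active edge `(v_i, v_{i+1})` of the ring with vertex set `ZMod N`,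
with dither value `v`. -/
def interact {N : ℕ} (α Δ : ℝ) (L : ℕ) (i : ZMod N) (q : ZMod N → ℝ) (v : ℝ) : ZMod N → ℝ :=
  let qi' := nearestSlot Δ L ((1 + α) / 2 * q i + (1 - α) / 2 * q (i + 1) + v)
  Function.update (Function.update q i qi') (i + 1) (q i + q (i + 1) - qi')

/-- The network state after `n` interactions, started from `q` with first active edge
`(v_i, v_{i+1})`. The active edge moves from `(v_j, v_{j+1})` to `(v_{j-1}, v_j)` after every
interaction, so the next interaction is across the edge with index `i - n`. -/
def evolve {N : ℕ} (α Δ : ℝ) (L : ℕ) (i : ZMod N) (q : ZMod N → ℝ) (v : ℕ → ℝ) : ℕ → ZMod N → ℝ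
  | 0 => q
  | n + 1 => interact α Δ L (i - (n : ZMod N)) (evolve α Δ L i q v n) (v n)

/-- A transition from `q` to `q'` across the edge `(v_i, v_{i+1})` is a compression. -/
def IsCompression {N : ℕ} (i : ZMod N) (q q' : ZMod N → ℝ) : Prop :=
  |q' i - q' (i + 1)| < |q i - q (i + 1)|

/-- The number of interactions up to and including the first compression
(`∞` if there is none). -/
def compressionTime {N : ℕ} (α Δ : ℝ) (L : ℕ) (i : ZMod N) (q : ZMod N → ℝ) (v : ℕ → ℝ) : ℝ≥0∞ :=
  ⨅ (n : ℕ) (_ : IsCompression (i - (n : ZMod N))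
      (evolve α Δ L i q v n) (evolve α Δ L i q v (n + 1))), ((n : ℝ≥0∞) + 1)

/-- The expected number of interactions up to and including the first compression. -/
def meanTime {N : ℕ} (α Δ : ℝ) (L : ℕ) (i : ZMod N) (q : ZMod N → ℝ) : ℝ≥0∞ :=
  ∫⁻ v, compressionTime α Δ L i q v ∂ditherLaw Δ

/-- The possible states of the network: positive slot lengths, multiples of `Δ`, with
sum `L Δ`. -/
def states (N : ℕ) [NeZero N] (Δ : ℝ) (L : ℕ) : Set (ZMod N → ℝ) :=
  {q | (∀ i, q i ∈ slots Δ L) ∧ (∀ i, Δ ≤ q i) ∧ ∑ i, q i = L * Δ}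

open scoped Classical in
/-- The TDM states: with `L = ℓ N + r`, `0 ≤ r < N`, exactly `r` nodes have `ℓ + 1` slots and all
others have `ℓ` slots. -/
def tdmStates (N : ℕ) [NeZero N] (Δ : ℝ) (L : ℕ) : Set (ZMod N → ℝ) :=
  {q | (Finset.univ.filter fun i => q i = ((L / N : ℕ) + 1 : ℝ) * Δ).card = L % N ∧
    ∀ i, q i ≠ ((L / N : ℕ) + 1 : ℝ) * Δ → q i = ((L / N : ℕ) : ℝ) * Δ}

/-- The states from which a compression still has to happen. -/
def unsettled (N : ℕ) [NeZero N] (Δ : ℝ) (L : ℕ) : Set (ZMod N → ℝ) :=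
  states N Δ L \ tdmStates N Δ L

/-- The maximal expected number of interactions until a compression, over all non-TDM states, when
the active edge is initially `(v_i, v_{i+1})`. -/
def maxMeanTime (N : ℕ) [NeZero N] (α Δ : ℝ) (L : ℕ) (i : ZMod N) : ℝ≥0∞ :=
  ⨆ q ∈ unsettled N Δ L, meanTime α Δ L i q

/-- The expected number of interactions until a compression when the values of `q` are first
placed on the ring in uniformly random order. -/
def placementMeanTime {N : ℕ} [NeZero N] (α Δ : ℝ) (L : ℕ) (i : ZMod N) (q : ZMod N → ℝ) :
    ℝ≥0∞ :=
  (∑ σ : Equiv.Perm (ZMod N), meanTime α Δ L i (q ∘ σ)) / (N.factorial : ℝ≥0∞)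

/-- The two-outlier configuration: `(ℓ + 1) Δ` at `a`, `(ℓ - 1) Δ` at `b`, and `ℓ Δ` elsewhere. -/
def twoOutlier {N : ℕ} (Δ : ℝ) (ell : ℕ) (a b : ZMod N) : ZMod N → ℝ := fun k =>
  if k = a then ((ell : ℝ) + 1) * Δ else if k = b then ((ell : ℝ) - 1) * Δ else (ell : ℝ) * Δ

/-- The average, over the `N (N - 1)` positions of the two outliers, of the expected number of
interactions until a compression. -/
def twoOutlierMeanTime (N : ℕ) [NeZero N] (α Δ : ℝ) (ell : ℕ) (i : ZMod N) : ℝ≥0∞ :=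
  (∑ a : ZMod N, ∑ b : ZMod N,
    if a ≠ b then meanTime α Δ (ell * N) i (twoOutlier Δ ell a b) else 0) /
    ((N * (N - 1) : ℕ) : ℝ≥0∞)

/-- The closed form of the worst-case expected number of interactions. -/
def closedForm (N : ℕ) (α : ℝ) : ℝ :=
  ((N : ℝ) ^ 4 * (α + 1) ^ 2 + (N : ℝ) ^ 3 * (α + 1) ^ 2 + 12 * (N : ℝ) ^ 2 * (α - 1) ^ 2
      - 24 * (N : ℝ) * (α - 1) * (2 * α - 1) + 24 * (α - 1) ^ 2) /
    (24 * (N : ℝ) * (1 - α) * (1 + α))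

/-- The constant `g(α)`. -/
def gConst (α : ℝ) : ℝ := (α + 1) / (24 * (1 - α))

end DitheredDesync

end

/-! ### Dither law, and the mean time as a sum of survival probabilities -/

namespace DitheredDesync

/-! Up to the first compression the dynamics only permutes the values. In units of `Δ`, neighbours
differing by at most one slot exchange their values with probability `(1 - α) / 2`. Neighbours
differing by at least two either keep their values or compress, and compress with probability at
least `1 - α`, exactly `1 - α` when the difference is two.

A non-TDM state has a maximal and a minimal value at least two slots apart. Follow this pair as two
tokens that are exchanged with their neighbours like everything else, but are killed with
probability `1 - α` whenever both lie on the active edge. If the edge carries another pair differing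
by at least two, survival costs a factor at most `α`, which is below the probability `(1 + α) / 2`
that the tokens stay. Hence the absence of compression is at most as likely as the survival of the
tokens (`noCompression_le_tokenSurvival`). In a two-outlier configuration no other pair differs by
two, and the bound is an equality (`noCompression_twoOutlier`). So the worst case is a two-outlier
configuration, whatever `L` is.

The mean lifetime of the tokens solves a finite linear system of first-step equations, and any
solution of the system is the lifetime (`hasSum_tokenSurvival`). In the frame of the active edge the
tokens off the edge advance by one node per step, so only positions with a token at `0` or `1`
matter; there the solution is quadratic in the other position (`headTime`, `tailTime`, verified in
`pairTime_eq`). Summing it over all pairs gives `closedForm` (`sum_pairTime`), and bounding it gives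
the growth estimate (`pairTime_le`). A uniformly random placement puts the extreme pair at a
uniformly random ordered pair of nodes (`sum_perm_apply_apply`), so the placement average equals the
pair average. -/

/-- An i.i.d. sequence is an independent first term followed by an i.i.d. sequence. -/
theorem map_cons_prod_infinitePi {X : Type*} [MeasurableSpace X] (μ : Measure X)
    [IsProbabilityMeasure μ] :
    (μ.prod (Measure.infinitePi fun _ : ℕ => μ)).map
      (fun z n => Nat.casesOn (motive := fun _ => X) n z.1 z.2) =
      Measure.infinitePi fun _ : ℕ => μ := by
  have hm : Measurable (fun (z : X × (ℕ → X)) (n : ℕ) =>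
      Nat.casesOn (motive := fun _ => X) n z.1 z.2) := by
    rw [measurable_pi_iff]
    rintro (_ | n)
    · exact measurable_fst
    · exact (measurable_pi_apply n).comp measurable_snd
  apply Measure.eq_infinitePi
  intro s t ht
  classical
  -- Padding with `Set.univ` makes the cylinder live on an initial segment of `ℕ`, where it splits
  -- into first coordinate times shifted tail.
  set t' : ℕ → Set X := fun i => if i ∈ s then t i else Set.univ with ht'
  have hmt' : ∀ i, MeasurableSet (t' i) := by
    intro i
    simp only [ht']
    split_ifs
    exacts [ht i, MeasurableSet.univ]
  obtain ⟨m, hm'⟩ : ∃ m, s ⊆ Finset.range (m + 1) :=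
    ⟨s.sup id, fun i hi => Finset.mem_range.2 (Nat.lt_succ_of_le (Finset.le_sup (f := id) hi))⟩
  have h1 : Set.pi (s : Set ℕ) t = Set.pi (Finset.range (m + 1) : Set ℕ) t' := by
    ext x
    simp only [Set.mem_pi, Finset.mem_coe, ht']
    refine ⟨fun h i _ => ?_, fun h i hi => ?_⟩
    · split_ifs with hi
      exacts [h i hi, Set.mem_univ _]
    · simpa [hi] using h i (hm' hi)
  have h2 : ∏ i ∈ s, μ (t i) = ∏ i ∈ Finset.range (m + 1), μ (t' i) := by
    have : ∀ i, μ (t' i) = if i ∈ s then μ (t i) else 1 := by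
      intro i
      simp only [ht']
      split_ifs <;> simp
    simp only [this]
    rw [Finset.prod_ite_mem, Finset.inter_eq_right.2 hm']
  rw [h1, h2, Measure.map_apply hm (MeasurableSet.pi (Finset.countable_toSet _) fun i _ => hmt' i)]
  have h3 : (fun (z : X × (ℕ → X)) (n : ℕ) => Nat.casesOn (motive := fun _ => X) n z.1 z.2) ⁻¹'
      Set.pi (Finset.range (m + 1) : Set ℕ) t' =
      t' 0 ×ˢ Set.pi (Finset.range m : Set ℕ) fun i => t' (i + 1) := by
    ext ⟨x, w⟩
    simp only [Set.mem_preimage, Set.mem_pi, Finset.mem_coe, Finset.mem_range, Set.mem_prod]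
    refine ⟨fun h => ⟨h 0 (Nat.succ_pos m), fun i hi => h (i + 1) (Nat.succ_lt_succ hi)⟩, ?_⟩
    rintro ⟨h0, h⟩ (_ | i) hi
    exacts [h0, h i (Nat.lt_of_succ_lt_succ hi)]
  rw [h3, Measure.prod_prod, Measure.infinitePi_pi _ fun i _ => hmt' _, Finset.prod_range_succ',
    mul_comm]

/-- The law of a single dither variable. -/
noncomputable def uniformDither (Δ : ℝ) : Measure ℝ :=
  ProbabilityTheory.cond (volume : Measure ℝ) (Set.Ioo (-(Δ / 2)) (Δ / 2))

theorem isProbabilityMeasure_uniformDither {Δ : ℝ} (hΔ : 0 < Δ) :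
    IsProbabilityMeasure (uniformDither Δ) := by
  refine cond_isProbabilityMeasure_of_finite ?_ ?_
  · rw [Real.volume_Ioo]
    simpa using hΔ
  · simp

theorem ae_abs_lt_uniformDither (Δ : ℝ) :
    ∀ᵐ v ∂uniformDither Δ, v ∈ Set.Ioo (-(Δ / 2)) (Δ / 2) :=
  ae_cond_mem measurableSet_Ioo

/-- The half-line is closed here and open in `uniformDither_lt` because `round` sends half-integers
up: these are exactly the events on which rounding leaves the own value for the upper, respectively
lower, one. -/
theorem uniformDither_ge {Δ s : ℝ} (hΔ : 0 < Δ) (hs1 : s ≤ 1) :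
    uniformDither Δ (Set.Ici ((1 / 2 - s) * Δ)) = ENNReal.ofReal s := by
  have h : (Set.Ioo (-(Δ / 2)) (Δ / 2) ∩ Set.Ici ((1 / 2 - s) * Δ) : Set ℝ) =ᵐ[volume]
      Set.Ioo ((1 / 2 - s) * Δ) (Δ / 2) := by
    have h1 : (Set.Ioo (-(Δ / 2)) (Δ / 2) ∩ Set.Ioi ((1 / 2 - s) * Δ) : Set ℝ) =
        Set.Ioo ((1 / 2 - s) * Δ) (Δ / 2) := by
      ext v
      simp only [Set.mem_inter_iff, Set.mem_Ioo, Set.mem_Ioi]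
      refine ⟨fun h => ⟨h.2, h.1.2⟩, fun h => ⟨⟨?_, h.2⟩, h.1⟩⟩
      nlinarith [h.1]
    rw [← h1]
    exact Filter.EventuallyEq.rfl.inter (Ioi_ae_eq_Ici (μ := volume)).symm
  rw [uniformDither, cond_apply measurableSet_Ioo, measure_congr h, Real.volume_Ioo,
    Real.volume_Ioo, ← ENNReal.ofReal_inv_of_pos (by linarith), ← ENNReal.ofReal_mul (by
      rw [inv_nonneg]; linarith)]
  congr 1
  field_simp
  ring

theorem uniformDither_lt {Δ s : ℝ} (hΔ : 0 < Δ) (hs1 : s ≤ 1) :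
    uniformDither Δ (Set.Iio ((s - 1 / 2) * Δ)) = ENNReal.ofReal s := by
  have h1 : (Set.Ioo (-(Δ / 2)) (Δ / 2) ∩ Set.Iio ((s - 1 / 2) * Δ) : Set ℝ) =
      Set.Ioo (-(Δ / 2)) ((s - 1 / 2) * Δ) := by
    ext v
    simp only [Set.mem_inter_iff, Set.mem_Ioo, Set.mem_Iio]
    refine ⟨fun h => ⟨h.1.1, h.2⟩, fun h => ⟨⟨h.1, ?_⟩, h.2⟩⟩
    nlinarith [h.2]
  rw [uniformDither, cond_apply measurableSet_Ioo, h1, Real.volume_Ioo,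
    Real.volume_Ioo, ← ENNReal.ofReal_inv_of_pos (by linarith), ← ENNReal.ofReal_mul (by
      rw [inv_nonneg]; linarith)]
  congr 1
  field_simp
  ring

open scoped Classical in
/-- The integral of a function taking one value on an event and another one off it. -/
theorem lintegral_two_valued {X : Type*} [MeasurableSpace X] (μ : Measure X)
    [IsProbabilityMeasure μ] {A : Set X} (hA : MeasurableSet A) {s : ℝ} (hs0 : 0 ≤ s)
    (hμ : μ A = ENNReal.ofReal s) (x y : ℝ≥0∞) :
    ∫⁻ v, (if v ∈ A then y else x) ∂μ =
      ENNReal.ofReal (1 - s) * x + ENNReal.ofReal s * y := by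
  have hc : μ Aᶜ = ENNReal.ofReal (1 - s) := by
    rw [prob_compl_eq_one_sub hA, hμ, ENNReal.ofReal_sub _ hs0, ENNReal.ofReal_one]
  rw [← lintegral_add_compl _ hA, setLIntegral_congr_fun hA (g := fun _ => y),
    setLIntegral_congr_fun hA.compl (g := fun _ => x), setLIntegral_const, setLIntegral_const, hμ,
    hc, add_comm, mul_comm x, mul_comm y]
  · intro v hv
    simp only [Set.mem_compl_iff] at hv
    simp [hv]
  · intro v hv
    simp [hv]

theorem measurable_nearestSlot (Δ : ℝ) (L : ℕ) : Measurable (nearestSlot Δ L) := by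
  unfold nearestSlot
  simp only [round_eq]
  refine Measurable.mul_const ?_ _
  refine (measurable_from_top (f := fun k : ℤ =>
    ((max 0 (min ((L : ℤ) - 1) k) : ℤ) : ℝ))).comp ?_
  exact Int.measurable_floor.comp (by fun_prop)

section Dynamics

variable {N : ℕ}

theorem measurable_interact (α Δ : ℝ) (L : ℕ) (i : ZMod N) :
    Measurable fun z : (ZMod N → ℝ) × ℝ => interact α Δ L i z.1 z.2 := by
  have hr : Measurable fun z : (ZMod N → ℝ) × ℝ => nearestSlot Δ L
      ((1 + α) / 2 * z.1 i + (1 - α) / 2 * z.1 (i + 1) + z.2) := by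
    refine (measurable_nearestSlot Δ L).comp ?_
    fun_prop
  have h1 : Measurable fun z : (ZMod N → ℝ) × ℝ => Function.update z.1 i
      (nearestSlot Δ L ((1 + α) / 2 * z.1 i + (1 - α) / 2 * z.1 (i + 1) + z.2)) :=
    (measurable_update' (X := fun _ : ZMod N => ℝ) (a := i)).comp (measurable_fst.prodMk hr)
  have h2 : Measurable fun z : (ZMod N → ℝ) × ℝ => z.1 i + z.1 (i + 1) - nearestSlot Δ L
      ((1 + α) / 2 * z.1 i + (1 - α) / 2 * z.1 (i + 1) + z.2) := by
    fun_prop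
  exact (measurable_update' (X := fun _ : ZMod N => ℝ) (a := i + 1)).comp (h1.prodMk h2)

theorem measurable_evolve (α Δ : ℝ) (L : ℕ) (i : ZMod N) (q : ZMod N → ℝ) (n : ℕ) :
    Measurable fun v : ℕ → ℝ => evolve α Δ L i q v n := by
  induction n with
  | zero => exact measurable_const
  | succ n ih =>
    have h : Measurable fun v : ℕ → ℝ => (evolve α Δ L i q v n, v n) :=
      ih.prodMk (measurable_pi_apply n)
    have h' := (measurable_interact α Δ L (i - (n : ZMod N))).comp h
    simp only [evolve]
    exact h'

/-- `evolve` recurses on the last interaction, whereas conditioning needs the first one split off.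
-/
theorem evolve_succ_eq (α Δ : ℝ) (L : ℕ) (i : ZMod N) (q : ZMod N → ℝ) (v : ℕ → ℝ) (n : ℕ) :
    evolve α Δ L i q v (n + 1) =
      evolve α Δ L (i - 1) (interact α Δ L i q (v 0)) (fun k => v (k + 1)) n := by
  induction n with
  | zero => simp [evolve]
  | succ n ih =>
    rw [evolve, ih, evolve]
    congr 1
    push_cast
    ring

/-- The event that none of the first `n` interactions is a compression. -/
def noCompression (α Δ : ℝ) (L : ℕ) (i : ZMod N) (q : ZMod N → ℝ) (n : ℕ) : Set (ℕ → ℝ) :=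
  {v | ∀ k < n, ¬ IsCompression (i - (k : ZMod N)) (evolve α Δ L i q v k)
    (evolve α Δ L i q v (k + 1))}

theorem measurableSet_noCompression (α Δ : ℝ) (L : ℕ) (i : ZMod N) (q : ZMod N → ℝ) (n : ℕ) :
    MeasurableSet (noCompression α Δ L i q n) := by
  have : noCompression α Δ L i q n = ⋂ k ∈ Set.Iio n, {v | ¬ IsCompression (i - (k : ZMod N))
      (evolve α Δ L i q v k) (evolve α Δ L i q v (k + 1))} := by
    ext v
    simp [noCompression]
  rw [this]
  refine MeasurableSet.biInter (Set.to_countable _) fun k _ => ?_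
  have h : ∀ m j, Measurable fun v : ℕ → ℝ => evolve α Δ L i q v m j := fun m j =>
    (measurable_pi_apply j).comp (measurable_evolve α Δ L i q m)
  simp only [IsCompression, not_lt]
  exact measurableSet_le ((h _ _).sub (h _ _)).abs ((h _ _).sub (h _ _)).abs

theorem mem_noCompression_succ (α Δ : ℝ) (L : ℕ) (i : ZMod N) (q : ZMod N → ℝ) (n : ℕ)
    (v : ℕ → ℝ) :
    v ∈ noCompression α Δ L i q (n + 1) ↔
      ¬ IsCompression i q (interact α Δ L i q (v 0)) ∧
        (fun k => v (k + 1)) ∈ noCompression α Δ L (i - 1) (interact α Δ L i q (v 0)) n := by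
  have key : ∀ k : ℕ, i - ((k + 1 : ℕ) : ZMod N) = i - 1 - (k : ZMod N) := by
    intro k
    push_cast
    ring
  simp only [noCompression, Set.mem_ofPred_eq]
  constructor
  · intro h
    refine ⟨by simpa [evolve] using h 0 (Nat.succ_pos n), fun k hk => ?_⟩
    have := h (k + 1) (Nat.succ_lt_succ hk)
    rwa [key, evolve_succ_eq, evolve_succ_eq] at this
  · rintro ⟨h0, h⟩ (_ | k) hk
    · simpa [evolve] using h0
    · rw [key, evolve_succ_eq, evolve_succ_eq]
      exact h k (Nat.lt_of_succ_lt_succ hk)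

-- A time is the number of `n` at which it has not yet been reached. The index `n = 0` always
-- counts, which accounts for the `+ 1` in `compressionTime`; without a compression both sides are
-- infinite.
open scoped Classical in
theorem compressionTime_eq_tsum (α Δ : ℝ) (L : ℕ) (i : ZMod N) (q : ZMod N → ℝ) (v : ℕ → ℝ) :
    compressionTime α Δ L i q v =
      ∑' n, (noCompression α Δ L i q n).indicator (fun _ => (1 : ℝ≥0∞)) v := by
  set P : ℕ → Prop := fun k => IsCompression (i - (k : ZMod N)) (evolve α Δ L i q v k)
    (evolve α Δ L i q v (k + 1)) with hP
  have hind : ∀ n, (noCompression α Δ L i q n).indicator (fun _ => (1 : ℝ≥0∞)) v =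
      if ∀ k < n, ¬ P k then 1 else 0 := by
    intro n
    rw [Set.indicator_apply]
    exact if_congr Iff.rfl rfl rfl
  simp only [hind]
  by_cases h : ∃ k, P k
  · have hle : ∀ n, (∀ k < n, ¬ P k) ↔ n ∈ Finset.range (Nat.find h + 1) := by
      intro n
      rw [Finset.mem_range, Nat.lt_succ_iff, Nat.le_find_iff]
    simp only [hle]
    rw [tsum_eq_sum (s := Finset.range (Nat.find h + 1)) (by intro b hb; simp [hb])]
    rw [Finset.sum_congr rfl (g := fun _ => 1) (by intro b hb; simp [hb])]
    simp only [Finset.sum_const, Finset.card_range, nsmul_eq_mul, mul_one]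
    push_cast
    apply le_antisymm
    · exact iInf₂_le (f := fun (n : ℕ) (_ : P n) => (n : ℝ≥0∞) + 1) _ (Nat.find_spec h)
    · refine le_iInf₂ fun n hn => ?_
      gcongr
      exact Nat.find_min' h hn
  · push Not at h
    have h1 : compressionTime α Δ L i q v = ⊤ := by
      simp only [compressionTime, iInf_eq_top]
      intro n hn
      exact absurd hn (h n)
    rw [h1]
    simp [h]

theorem meanTime_eq_tsum (α Δ : ℝ) (L : ℕ) (i : ZMod N) (q : ZMod N → ℝ) :
    meanTime α Δ L i q = ∑' n, ditherLaw Δ (noCompression α Δ L i q n) := by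
  simp only [meanTime, compressionTime_eq_tsum]
  rw [lintegral_tsum fun n => (measurable_const.indicator
    (measurableSet_noCompression α Δ L i q n)).aemeasurable]
  congr 1
  ext n
  rw [lintegral_indicator (measurableSet_noCompression α Δ L i q n)]
  simp

theorem ditherLaw_noCompression_zero {Δ : ℝ} (hΔ : 0 < Δ) (α : ℝ) (L : ℕ) (i : ZMod N)
    (q : ZMod N → ℝ) : ditherLaw Δ (noCompression α Δ L i q 0) = 1 := by
  have := isProbabilityMeasure_uniformDither hΔ
  have h : noCompression α Δ L i q 0 = Set.univ := by
    ext v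
    simp [noCompression]
  rw [h]
  exact measure_univ (μ := Measure.infinitePi fun _ : ℕ => uniformDither Δ)

open scoped Classical in
/-- Conditioning on the first interaction. -/
theorem ditherLaw_noCompression_succ {Δ : ℝ} (hΔ : 0 < Δ) (α : ℝ) (L : ℕ) (i : ZMod N)
    (q : ZMod N → ℝ) (n : ℕ) :
    ditherLaw Δ (noCompression α Δ L i q (n + 1)) =
      ∫⁻ x, (if IsCompression i q (interact α Δ L i q x) then 0 else
        ditherLaw Δ (noCompression α Δ L (i - 1) (interact α Δ L i q x) n)) ∂uniformDither Δ := by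
  have := isProbabilityMeasure_uniformDither hΔ
  have hm : Measurable (fun (z : ℝ × (ℕ → ℝ)) (n : ℕ) =>
      Nat.casesOn (motive := fun _ => ℝ) n z.1 z.2) := by
    rw [measurable_pi_iff]
    rintro (_ | n)
    · exact measurable_fst
    · exact (measurable_pi_apply n).comp measurable_snd
  have hS := measurableSet_noCompression α Δ L i q (n + 1)
  have hlaw : ditherLaw Δ = Measure.infinitePi fun _ : ℕ => uniformDither Δ := rfl
  conv_lhs => rw [hlaw, ← map_cons_prod_infinitePi, Measure.map_apply hm hS,
    Measure.prod_apply (hm hS)]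
  refine lintegral_congr fun x => ?_
  rw [← hlaw]
  split_ifs with hc
  · rw [show (Prod.mk x ⁻¹' _ : Set (ℕ → ℝ)) = ∅ from ?_, measure_empty]
    ext w
    simp only [Set.mem_preimage, mem_noCompression_succ, Set.mem_empty_iff_false, iff_false]
    exact fun h => h.1 hc
  · congr 1
    ext w
    simp only [Set.mem_preimage, mem_noCompression_succ]
    exact ⟨fun h => h.2, fun h => ⟨hc, h⟩⟩

end Dynamics

end DitheredDesync

/-! ### Integer slot numbers and one-step transition probabilities -/

namespace DitheredDesync

/-- The real state with integer slot numbers `z`. -/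
def scaled {N : ℕ} (Δ : ℝ) (z : ZMod N → ℤ) : ZMod N → ℝ := fun k => (z k : ℝ) * Δ

/-- The slot number given to `v_i` when nodes with slot numbers `a`, `b` interact under the
normalised dither value `t`. -/
noncomputable def slotChoice (α : ℝ) (L : ℕ) (a b : ℤ) (t : ℝ) : ℤ :=
  max 0 (min ((L : ℤ) - 1) (round ((a : ℝ) + (1 - α) / 2 * (b - a) + t)))

theorem slotChoice_eq {α t : ℝ} {L : ℕ} {a b c : ℤ} (hc0 : 0 ≤ c) (hcL : c ≤ (L : ℤ) - 1)
    (h1 : (c : ℝ) - 1 / 2 ≤ a + (1 - α) / 2 * (b - a) + t)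
    (h2 : (a : ℝ) + (1 - α) / 2 * (b - a) + t < c + 1 / 2) : slotChoice α L a b t = c := by
  have : round ((a : ℝ) + (1 - α) / 2 * (b - a) + t) = c := round_eq_iff.2 ⟨h1, h2⟩
  rw [slotChoice, this, min_eq_right hcL, max_eq_right hc0]

theorem slotChoice_mem {α t : ℝ} {L : ℕ} {a b c d : ℤ} (hc0 : 0 ≤ c) (hdL : d ≤ (L : ℤ) - 1)
    (h1 : (c : ℝ) - 1 / 2 ≤ a + (1 - α) / 2 * (b - a) + t)
    (h2 : (a : ℝ) + (1 - α) / 2 * (b - a) + t < d + 1 / 2) :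
    c ≤ slotChoice α L a b t ∧ slotChoice α L a b t ≤ d := by
  have h3 : c ≤ round ((a : ℝ) + (1 - α) / 2 * (b - a) + t) := by
    rw [round_eq, Int.le_floor]
    linarith
  have h4 : round ((a : ℝ) + (1 - α) / 2 * (b - a) + t) ≤ d := by
    rw [round_eq, ← Int.lt_add_one_iff, Int.floor_lt]
    push_cast
    linarith
  rw [slotChoice]
  omega

section Dynamics

variable {N : ℕ}

theorem interact_scaled {Δ : ℝ} (hΔ : 0 < Δ) (α : ℝ) (L : ℕ) (i : ZMod N) (z : ZMod N → ℤ)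
    (v : ℝ) :
    interact α Δ L i (scaled Δ z) v =
      scaled Δ (Function.update (Function.update z i (slotChoice α L (z i) (z (i + 1)) (v / Δ)))
        (i + 1) (z i + z (i + 1) - slotChoice α L (z i) (z (i + 1)) (v / Δ))) := by
  have h : nearestSlot Δ L ((1 + α) / 2 * scaled Δ z i + (1 - α) / 2 * scaled Δ z (i + 1) + v) =
      (slotChoice α L (z i) (z (i + 1)) (v / Δ) : ℝ) * Δ := by
    rw [nearestSlot, slotChoice]
    congr 5
    simp only [scaled]
    field_simp
    ring
  ext k
  simp only [interact]
  rw [h]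
  simp only [scaled, Function.update_apply]
  split_ifs <;> push_cast <;> ring

theorem isCompression_scaled {Δ : ℝ} (hΔ : 0 < Δ) (i : ZMod N) (z z' : ZMod N → ℤ) :
    IsCompression i (scaled Δ z) (scaled Δ z') ↔
      |z' i - z' (i + 1)| < |z i - z (i + 1)| := by
  have h : ∀ y : ZMod N → ℤ, |scaled Δ y i - scaled Δ y (i + 1)| =
      ((|y i - y (i + 1)| : ℤ) : ℝ) * Δ := by
    intro y
    rw [scaled, scaled, ← sub_mul, abs_mul, abs_of_pos hΔ]
    push_cast
    rfl
  rw [IsCompression, h, h, mul_lt_mul_iff_left₀ hΔ, Int.cast_lt]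

theorem ne_add_one (hN : 2 ≤ N) (i : ZMod N) : i ≠ i + 1 := by
  have : Fact (1 < N) := ⟨hN⟩
  simp

theorem interact_scaled_of_keep {Δ : ℝ} (hΔ : 0 < Δ) {α : ℝ} {L : ℕ} {i : ZMod N}
    {z : ZMod N → ℤ} {v : ℝ} (h : slotChoice α L (z i) (z (i + 1)) (v / Δ) = z i) :
    interact α Δ L i (scaled Δ z) v = scaled Δ z := by
  rw [interact_scaled hΔ, h, Function.update_eq_self, add_sub_cancel_left, Function.update_eq_self]

theorem interact_scaled_of_swap {Δ : ℝ} (hΔ : 0 < Δ) {α : ℝ} {L : ℕ} {i : ZMod N}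
    {z : ZMod N → ℤ} {v : ℝ} (h : slotChoice α L (z i) (z (i + 1)) (v / Δ) = z (i + 1)) :
    interact α Δ L i (scaled Δ z) v = scaled Δ (z ∘ Equiv.swap i (i + 1)) := by
  rw [interact_scaled hΔ, h, add_sub_cancel_right]
  congr 1
  ext k
  simp only [Function.update_apply, Function.comp_apply, Equiv.swap_apply_def]
  split_ifs <;> simp_all

theorem isCompression_interact_iff {Δ : ℝ} (hΔ : 0 < Δ) (hN : 2 ≤ N) {α : ℝ} {L : ℕ} {i : ZMod N}
    {z : ZMod N → ℤ} {v : ℝ} :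
    IsCompression i (scaled Δ z) (interact α Δ L i (scaled Δ z) v) ↔
      |2 * slotChoice α L (z i) (z (i + 1)) (v / Δ) - (z i + z (i + 1))| <
        |z i - z (i + 1)| := by
  rw [interact_scaled hΔ, isCompression_scaled hΔ, Function.update_self,
    Function.update_of_ne (ne_add_one hN i), Function.update_self]
  ring_nf

open scoped Classical in
/-- Neighbours whose values differ by at most one slot exchange them with probability
`(1 - α) / 2`, and never compress. -/
theorem noCompression_succ_of_abs_le_one {α Δ : ℝ} (hα0 : 0 < α) (hα1 : α < 1) (hΔ : 0 < Δ)
    (hN : 2 ≤ N) {L : ℕ} {i : ZMod N} {z : ZMod N → ℤ} (h : |z i - z (i + 1)| ≤ 1)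
    (hi0 : 0 ≤ z i) (hiL : z i ≤ (L : ℤ) - 1) (hj0 : 0 ≤ z (i + 1))
    (hjL : z (i + 1) ≤ (L : ℤ) - 1) (n : ℕ) :
    ditherLaw Δ (noCompression α Δ L i (scaled Δ z) (n + 1)) =
      ENNReal.ofReal (1 - (1 - α) / 2) *
          ditherLaw Δ (noCompression α Δ L (i - 1) (scaled Δ z) n) +
        ENNReal.ofReal ((1 - α) / 2) *
          ditherLaw Δ (noCompression α Δ L (i - 1) (scaled Δ (z ∘ Equiv.swap i (i + 1))) n) := by
  have := isProbabilityMeasure_uniformDither hΔ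
  have hs0 : 0 ≤ (1 - α) / 2 := by linarith
  have hs1 : (1 - α) / 2 ≤ 1 := by linarith
  have key : ∀ A : Set ℝ, MeasurableSet A → uniformDither Δ A = ENNReal.ofReal ((1 - α) / 2) →
      (∀ v ∈ Set.Ioo (-(Δ / 2)) (Δ / 2), slotChoice α L (z i) (z (i + 1)) (v / Δ) =
        if v ∈ A then z (i + 1) else z i) →
      ditherLaw Δ (noCompression α Δ L i (scaled Δ z) (n + 1)) =
      ENNReal.ofReal (1 - (1 - α) / 2) *
          ditherLaw Δ (noCompression α Δ L (i - 1) (scaled Δ z) n) +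
        ENNReal.ofReal ((1 - α) / 2) *
          ditherLaw Δ (noCompression α Δ L (i - 1)
            (scaled Δ (z ∘ Equiv.swap i (i + 1))) n) := by
    intro A hA hμ hch
    rw [ditherLaw_noCompression_succ hΔ, ← lintegral_two_valued _ hA hs0 hμ]
    refine lintegral_congr_ae ?_
    filter_upwards [ae_abs_lt_uniformDither Δ] with v hv
    have hc := hch v hv
    rw [if_neg]
    · split_ifs at hc ⊢ with hvA
      · rw [interact_scaled_of_swap hΔ hc]
      · rw [interact_scaled_of_keep hΔ hc]
    · rw [isCompression_interact_iff hΔ hN, hc, not_lt]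
      split_ifs
      · rw [abs_sub_comm (z i)]
        apply le_of_eq
        congr 1
        ring
      · apply le_of_eq
        congr 1
        ring
  have hd : z (i + 1) = z i ∨ z (i + 1) = z i + 1 ∨ z (i + 1) = z i - 1 := by
    rw [abs_le] at h
    omega
  have hv : ∀ v ∈ Set.Ioo (-(Δ / 2)) (Δ / 2), -(1 / 2) < v / Δ ∧ v / Δ < 1 / 2 := by
    intro v hv
    rw [lt_div_iff₀ hΔ, div_lt_iff₀ hΔ]
    constructor <;> linarith [hv.1, hv.2]
  rcases hd with hd | hd | hd
  -- For equal values keeping and exchanging coincide, so any event of the right probability serves.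
  · refine key _ measurableSet_Ici (uniformDither_ge hΔ hs1) fun v hv' => ?_
    obtain ⟨h1, h2⟩ := hv v hv'
    rw [hd, ite_self]
    apply slotChoice_eq hi0 hiL <;> linarith
  · refine key _ measurableSet_Ici (uniformDither_ge hΔ hs1) fun v hv' => ?_
    obtain ⟨h1, h2⟩ := hv v hv'
    have hcast : (z (i + 1) : ℝ) = z i + 1 := by rw [hd]; push_cast; ring
    have hiff : (1 / 2 - (1 - α) / 2) * Δ ≤ v ↔ 1 / 2 - (1 - α) / 2 ≤ v / Δ := (le_div_iff₀ hΔ).symm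
    simp only [Set.mem_Ici, hiff]
    split_ifs with hA
    · apply slotChoice_eq hj0 hjL <;> rw [hcast] <;> linarith
    · apply slotChoice_eq hi0 hiL <;> rw [hcast] <;> linarith
  · refine key _ measurableSet_Iio (uniformDither_lt hΔ hs1) fun v hv' => ?_
    obtain ⟨h1, h2⟩ := hv v hv'
    have hcast : (z (i + 1) : ℝ) = z i - 1 := by rw [hd]; push_cast; ring
    have hiff : v < ((1 - α) / 2 - 1 / 2) * Δ ↔ v / Δ < (1 - α) / 2 - 1 / 2 := (div_lt_iff₀ hΔ).symm
    simp only [Set.mem_Iio, hiff]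
    split_ifs with hA
    · apply slotChoice_eq hj0 hjL <;> rw [hcast] <;> linarith
    · apply slotChoice_eq hi0 hiL <;> rw [hcast] <;> linarith

/-- When the values of neighbours differ by at least two slots, an event of probability `1 - α`
forces a compression; off it, either the values stay put or there is a compression, and the values
do stay put if they differ by exactly two slots. -/
theorem exists_compression_event {α Δ : ℝ} (hα0 : 0 < α) (hα1 : α < 1) (hΔ : 0 < Δ)
    (hN : 2 ≤ N) {L : ℕ} {i : ZMod N} {z : ZMod N → ℤ} (h : 2 ≤ |z i - z (i + 1)|)
    (hi0 : 0 ≤ z i) (hiL : z i ≤ (L : ℤ) - 1) (hj0 : 0 ≤ z (i + 1))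
    (hjL : z (i + 1) ≤ (L : ℤ) - 1) :
    ∃ A : Set ℝ, MeasurableSet A ∧ uniformDither Δ A = ENNReal.ofReal (1 - α) ∧
      ∀ v ∈ Set.Ioo (-(Δ / 2)) (Δ / 2),
        (v ∈ A → IsCompression i (scaled Δ z) (interact α Δ L i (scaled Δ z) v)) ∧
        (IsCompression i (scaled Δ z) (interact α Δ L i (scaled Δ z) v) ∨
          interact α Δ L i (scaled Δ z) v = scaled Δ z) ∧
        (|z i - z (i + 1)| = 2 → v ∉ A → interact α Δ L i (scaled Δ z) v = scaled Δ z) := by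
  have hv : ∀ v ∈ Set.Ioo (-(Δ / 2)) (Δ / 2), -(1 / 2) < v / Δ ∧ v / Δ < 1 / 2 := by
    intro v hv
    rw [lt_div_iff₀ hΔ, div_lt_iff₀ hΔ]
    constructor <;> linarith [hv.1, hv.2]
  have hd : z i + 2 ≤ z (i + 1) ∨ z (i + 1) + 2 ≤ z i := by
    rw [le_abs] at h
    omega
  rcases hd with hd | hd
  · refine ⟨_, measurableSet_Ici, uniformDither_ge hΔ (by linarith), fun v hv' => ?_⟩
    obtain ⟨h1, h2⟩ := hv v hv'
    have hcast : (z i : ℝ) + 2 ≤ z (i + 1) := by exact_mod_cast hd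
    have habs : |z i - z (i + 1)| = z (i + 1) - z i := by
      rw [abs_of_nonpos] <;> omega
    have hiff : (1 / 2 - (1 - α)) * Δ ≤ v ↔ 1 / 2 - (1 - α) ≤ v / Δ := (le_div_iff₀ hΔ).symm
    -- For a difference of at least two the new value never reaches the neighbour's, so a full
    -- exchange is impossible: the value is kept or lands strictly in between.
    have hmem : z i ≤ slotChoice α L (z i) (z (i + 1)) (v / Δ) ∧
        slotChoice α L (z i) (z (i + 1)) (v / Δ) ≤ z (i + 1) - 1 := by
      apply slotChoice_mem hi0 (by omega)
      · nlinarith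
      · push_cast
        nlinarith
    simp only [Set.mem_Ici, hiff, isCompression_interact_iff hΔ hN, habs, abs_lt]
    refine ⟨fun hA => ?_, ?_, fun h2' hA => ?_⟩
    · have := slotChoice_mem (α := α) (t := v / Δ) (L := L) (a := z i) (b := z (i + 1))
        (c := z i + 1) (d := z (i + 1) - 1) (by omega) (by omega)
        (by push_cast; nlinarith) (by push_cast; nlinarith)
      omega
    · rcases eq_or_lt_of_le hmem.1 with h3 | h3
      · exact Or.inr (interact_scaled_of_keep hΔ h3.symm)
      · left
        omega
    · have hcast' : (z (i + 1) : ℝ) = z i + 2 := by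
        have : z (i + 1) = z i + 2 := by omega
        rw [this]
        push_cast
        ring
      refine interact_scaled_of_keep hΔ (slotChoice_eq hi0 hiL ?_ ?_) <;> rw [hcast'] <;> linarith
  · refine ⟨_, measurableSet_Iio, uniformDither_lt hΔ (by linarith), fun v hv' => ?_⟩
    obtain ⟨h1, h2⟩ := hv v hv'
    have hcast : (z (i + 1) : ℝ) + 2 ≤ z i := by exact_mod_cast hd
    have habs : |z i - z (i + 1)| = z i - z (i + 1) := by
      rw [abs_of_nonneg]; omega
    have hiff : v < ((1 - α) - 1 / 2) * Δ ↔ v / Δ < (1 - α) - 1 / 2 := (div_lt_iff₀ hΔ).symm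
    have hmem : z (i + 1) + 1 ≤ slotChoice α L (z i) (z (i + 1)) (v / Δ) ∧
        slotChoice α L (z i) (z (i + 1)) (v / Δ) ≤ z i := by
      apply slotChoice_mem (by omega) hiL
      · push_cast
        nlinarith
      · nlinarith
    simp only [Set.mem_Iio, hiff, isCompression_interact_iff hΔ hN, habs, abs_lt]
    refine ⟨fun hA => ?_, ?_, fun h2' hA => ?_⟩
    · have := slotChoice_mem (α := α) (t := v / Δ) (L := L) (a := z i) (b := z (i + 1))
        (c := z (i + 1) + 1) (d := z i - 1) (by omega) (by omega)
        (by push_cast; nlinarith) (by push_cast; nlinarith)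
      omega
    · rcases eq_or_lt_of_le hmem.2 with h3 | h3
      · exact Or.inr (interact_scaled_of_keep hΔ h3)
      · left
        omega
    · have hcast' : (z (i + 1) : ℝ) = z i - 2 := by
        have : z (i + 1) = z i - 2 := by omega
        rw [this]
        push_cast
        ring
      refine interact_scaled_of_keep hΔ (slotChoice_eq hi0 hiL ?_ ?_) <;> rw [hcast'] <;> linarith

-- Only an inequality, since for differences above two a compression may also occur off the forcing
-- event.
open scoped Classical in
theorem noCompression_succ_le_of_two_le_abs {α Δ : ℝ} (hα0 : 0 < α) (hα1 : α < 1) (hΔ : 0 < Δ)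
    (hN : 2 ≤ N) {L : ℕ} {i : ZMod N} {z : ZMod N → ℤ} (h : 2 ≤ |z i - z (i + 1)|)
    (hi0 : 0 ≤ z i) (hiL : z i ≤ (L : ℤ) - 1) (hj0 : 0 ≤ z (i + 1))
    (hjL : z (i + 1) ≤ (L : ℤ) - 1) (n : ℕ) :
    ditherLaw Δ (noCompression α Δ L i (scaled Δ z) (n + 1)) ≤
      ENNReal.ofReal α * ditherLaw Δ (noCompression α Δ L (i - 1) (scaled Δ z) n) := by
  have := isProbabilityMeasure_uniformDither hΔ
  obtain ⟨A, hA, hμ, hch⟩ := exists_compression_event hα0 hα1 hΔ hN h hi0 hiL hj0 hjL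
  have hint := lintegral_two_valued _ hA (by linarith) hμ
    (ditherLaw Δ (noCompression α Δ L (i - 1) (scaled Δ z) n)) 0
  rw [mul_zero, add_zero, sub_sub_cancel] at hint
  rw [ditherLaw_noCompression_succ hΔ, ← hint]
  refine lintegral_mono_ae ?_
  filter_upwards [ae_abs_lt_uniformDither Δ] with v hv
  obtain ⟨h1, h2, -⟩ := hch v hv
  split_ifs with hc hvA hvA
  · exact le_rfl
  · exact zero_le
  · exact absurd (h1 hvA) hc
  · rw [h2.resolve_left hc]

open scoped Classical in
theorem noCompression_succ_of_abs_eq_two {α Δ : ℝ} (hα0 : 0 < α) (hα1 : α < 1) (hΔ : 0 < Δ)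
    (hN : 2 ≤ N) {L : ℕ} {i : ZMod N} {z : ZMod N → ℤ} (h : |z i - z (i + 1)| = 2)
    (hi0 : 0 ≤ z i) (hiL : z i ≤ (L : ℤ) - 1) (hj0 : 0 ≤ z (i + 1))
    (hjL : z (i + 1) ≤ (L : ℤ) - 1) (n : ℕ) :
    ditherLaw Δ (noCompression α Δ L i (scaled Δ z) (n + 1)) =
      ENNReal.ofReal α * ditherLaw Δ (noCompression α Δ L (i - 1) (scaled Δ z) n) := by
  have := isProbabilityMeasure_uniformDither hΔ
  obtain ⟨A, hA, hμ, hch⟩ := exists_compression_event hα0 hα1 hΔ hN h.ge hi0 hiL hj0 hjL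
  have hint := lintegral_two_valued _ hA (by linarith) hμ
    (ditherLaw Δ (noCompression α Δ L (i - 1) (scaled Δ z) n)) 0
  rw [mul_zero, add_zero, sub_sub_cancel] at hint
  rw [ditherLaw_noCompression_succ hΔ, ← hint]
  refine lintegral_congr_ae ?_
  filter_upwards [ae_abs_lt_uniformDither Δ] with v hv
  obtain ⟨h1, -, h2⟩ := hch v hv
  by_cases hvA : v ∈ A
  · rw [if_pos (h1 hvA), if_pos hvA]
  · have h3 := h2 h hvA
    rw [h3, if_neg hvA, if_neg]
    simp [IsCompression]

end Dynamics

end DitheredDesync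

/-! ### A pair of tokens with killing, and its comparison with the dynamics -/

namespace DitheredDesync

section Tokens

variable {N : ℕ}

/-- The one-step operator of a pair of tokens on the ring, seen from the active edge `(0, 1)`: the
edge moves on by one, after its ends were exchanged with probability `(1 - α) / 2`; if it carries
both tokens, they stay, and the pair is killed with probability `1 - α`. -/
noncomputable def tokenStep (α : ℝ) (f : ZMod N → ZMod N → ℝ) (x y : ZMod N) : ℝ :=
  if x = 0 ∧ y = 1 ∨ x = 1 ∧ y = 0 then α * f (x + 1) (y + 1) else
    (1 - (1 - α) / 2) * f (x + 1) (y + 1) +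
      (1 - α) / 2 * f (Equiv.swap 0 1 x + 1) (Equiv.swap 0 1 y + 1)

/-- The probability that a pair of tokens is alive after `n` steps. -/
noncomputable def tokenSurvival (α : ℝ) (n : ℕ) : ZMod N → ZMod N → ℝ :=
  (tokenStep α)^[n] fun _ _ => 1

theorem tokenSurvival_zero (α : ℝ) (x y : ZMod N) : tokenSurvival α 0 x y = 1 := rfl

theorem tokenSurvival_succ (α : ℝ) (n : ℕ) :
    tokenSurvival (N := N) α (n + 1) = tokenStep α (tokenSurvival α n) :=
  Function.iterate_succ_apply' _ _ _

/-- Shift and exchange are injective, so distinct tokens stay distinct and values on the diagonal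
never enter. -/
theorem tokenStep_mono {α : ℝ} (hα0 : 0 < α) (hα1 : α < 1) {f g : ZMod N → ZMod N → ℝ}
    (h : ∀ x y, x ≠ y → f x y ≤ g x y) {x y : ZMod N} (hxy : x ≠ y) :
    tokenStep α f x y ≤ tokenStep α g x y := by
  have h1 := h (x + 1) (y + 1) (by simpa using hxy)
  have h2 := h (Equiv.swap 0 1 x + 1) (Equiv.swap 0 1 y + 1) (by simpa using hxy)
  have h3 : 0 ≤ (1 - α) / 2 := by linarith
  have h4 : 0 ≤ 1 - (1 - α) / 2 := by linarith
  unfold tokenStep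
  split_ifs <;> gcongr

theorem tokenStep_add (α : ℝ) (f g : ZMod N → ZMod N → ℝ) (x y : ZMod N) :
    tokenStep α (fun a b => f a b + g a b) x y = tokenStep α f x y + tokenStep α g x y := by
  unfold tokenStep
  split_ifs <;> ring

theorem tokenStep_const_mul (α c : ℝ) (f : ZMod N → ZMod N → ℝ) (x y : ZMod N) :
    tokenStep α (fun a b => c * f a b) x y = c * tokenStep α f x y := by
  unfold tokenStep
  split_ifs <;> ring

theorem tokenStep_congr {α : ℝ} (hα0 : 0 < α) (hα1 : α < 1) {f g : ZMod N → ZMod N → ℝ}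
    (h : ∀ x y, x ≠ y → f x y = g x y) {x y : ZMod N} (hxy : x ≠ y) :
    tokenStep α f x y = tokenStep α g x y :=
  le_antisymm (tokenStep_mono hα0 hα1 (fun x y h' => (h x y h').le) hxy)
    (tokenStep_mono hα0 hα1 (fun x y h' => (h x y h').ge) hxy)

theorem tokenSurvival_nonneg {α : ℝ} (hα0 : 0 < α) (hα1 : α < 1) (n : ℕ) (x y : ZMod N) :
    0 ≤ tokenSurvival α n x y := by
  induction n generalizing x y with
  | zero => simp [tokenSurvival_zero]
  | succ n ih =>
    have h3 : 0 ≤ (1 - α) / 2 := by linarith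
    have h4 : 0 ≤ 1 - (1 - α) / 2 := by linarith
    rw [tokenSurvival_succ, tokenStep]
    split_ifs
    · exact mul_nonneg hα0.le (ih _ _)
    · exact add_nonneg (mul_nonneg h4 (ih _ _)) (mul_nonneg h3 (ih _ _))

theorem tokenSurvival_le_one {α : ℝ} (hα0 : 0 < α) (hα1 : α < 1) (n : ℕ) (x y : ZMod N) :
    tokenSurvival α n x y ≤ 1 := by
  induction n generalizing x y with
  | zero => simp [tokenSurvival_zero]
  | succ n ih =>
    rw [tokenSurvival_succ, tokenStep]
    split_ifs
    · nlinarith [ih (x + 1) (y + 1)]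
    · nlinarith [ih (x + 1) (y + 1), ih (Equiv.swap 0 1 x + 1) (Equiv.swap 0 1 y + 1)]

/-- A solution of the first-step equations is the mean lifetime of a pair of tokens. -/
theorem hasSum_tokenSurvival [NeZero N] {α : ℝ} (hα0 : 0 < α) (hα1 : α < 1)
    {H : ZMod N → ZMod N → ℝ} (hH : ∀ x y, x ≠ y → H x y = 1 + tokenStep α H x y)
    {x y : ZMod N} (hxy : x ≠ y) : HasSum (fun n => tokenSurvival α n x y) (H x y) := by
  obtain ⟨c, hc0, hc⟩ : ∃ c : ℝ, 0 ≤ c ∧ ∀ x y, |H x y| ≤ c := by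
    refine ⟨∑ z : ZMod N × ZMod N, |H z.1 z.2|, Finset.sum_nonneg fun _ _ => abs_nonneg _,
      fun x y => ?_⟩
    exact Finset.single_le_sum (f := fun z : ZMod N × ZMod N => |H z.1 z.2|)
      (fun _ _ => abs_nonneg _) (Finset.mem_univ (x, y))
  have hR : ∀ n, (tokenStep α)^[n + 1] H = tokenStep α ((tokenStep α)^[n] H) :=
    fun n => Function.iterate_succ_apply' _ _ _
  have hup : ∀ n x y, x ≠ y → (tokenStep α)^[n] H x y ≤ c * tokenSurvival α n x y := by
    intro n
    induction n with
    | zero =>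
      intro x y _
      simpa [tokenSurvival_zero] using (abs_le.1 (hc x y)).2
    | succ n ih =>
      intro x y hxy
      rw [hR, tokenSurvival_succ, ← tokenStep_const_mul]
      exact tokenStep_mono hα0 hα1 ih hxy
  have hlow : ∀ n x y, x ≠ y → (-c) * tokenSurvival α n x y ≤ (tokenStep α)^[n] H x y := by
    intro n
    induction n with
    | zero =>
      intro x y _
      simpa [tokenSurvival_zero] using (abs_le.1 (hc x y)).1
    | succ n ih =>
      intro x y hxy
      rw [hR, tokenSurvival_succ, ← tokenStep_const_mul]
      exact tokenStep_mono hα0 hα1 ih hxy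
  -- Iterating the equation leaves the remainder `(tokenStep α)^[n] H`, which `hup` and `hlow` trap
  -- between `± c` times the survival probability.
  have hsum : ∀ n x y, x ≠ y → H x y =
      ∑ k ∈ Finset.range n, tokenSurvival α k x y + (tokenStep α)^[n] H x y := by
    intro n
    induction n with
    | zero =>
      intro x y _
      simp
    | succ n ih =>
      intro x y hxy
      have hstep : ∀ m, tokenStep α (fun x y => ∑ k ∈ Finset.range m, tokenSurvival α k x y) x y =
          ∑ k ∈ Finset.range m, tokenSurvival α (k + 1) x y := by
        intro m
        induction m with
        | zero => simp [tokenStep]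
        | succ m ihm =>
          simp only [Finset.sum_range_succ, tokenSurvival_succ] at ihm ⊢
          rw [tokenStep_add, ihm]
      rw [hH x y hxy, tokenStep_congr hα0 hα1 ih hxy, tokenStep_add, hstep, ← hR,
        Finset.sum_range_succ', tokenSurvival_zero]
      ring
  have hnn := fun n => tokenSurvival_nonneg hα0 hα1 n x y
  -- The remainder is at least `-c`, so the partial sums are at most `H x y + c`. Summability then
  -- forces survival, and with it the remainder, to zero: almost sure killing is a consequence and
  -- need not be known beforehand.
  have hsummable : Summable fun n => tokenSurvival α n x y := by
    refine summable_of_sum_range_le (c := H x y + c) hnn fun n => ?_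
    nlinarith [hsum n x y hxy, hlow n x y hxy, tokenSurvival_le_one hα0 hα1 n x y]
  have hzero := hsummable.tendsto_atTop_zero
  have hR0 : Tendsto (fun n => (tokenStep α)^[n] H x y) atTop (nhds 0) := by
    refine tendsto_of_tendsto_of_tendsto_of_le_of_le (g := fun n => (-c) * tokenSurvival α n x y)
      (h := fun n => c * tokenSurvival α n x y) ?_ ?_ (fun n => hlow n x y hxy)
      (fun n => hup n x y hxy)
    · simpa using hzero.const_mul (-c)
    · simpa using hzero.const_mul c
  rw [hasSum_iff_tendsto_nat_of_nonneg hnn]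
  have : (fun n => ∑ k ∈ Finset.range n, tokenSurvival α k x y) =
      fun n => H x y - (tokenStep α)^[n] H x y := by
    ext n
    linarith [hsum n x y hxy]
  rw [this]
  simpa using tendsto_const_nhds.sub hR0

/-- Change of frame: as the active edge steps back from `i` to `i - 1`, positions relative to it
advance by one. -/
theorem swap_sub (i a : ZMod N) :
    Equiv.swap i (i + 1) a - (i - 1) = Equiv.swap 0 1 (a - i) + 1 := by
  have h1 : a - i = 0 ↔ a = i := sub_eq_zero
  have h2 : a - i = 1 ↔ a = i + 1 := by rw [sub_eq_iff_eq_add, add_comm]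
  simp only [Equiv.swap_apply_def, h1, h2]
  split_ifs <;> ring

theorem edge_iff (i a b : ZMod N) :
    (a - i = 0 ∧ b - i = 1 ∨ a - i = 1 ∧ b - i = 0) ↔ (a = i ∧ b = i + 1 ∨ a = i + 1 ∧ b = i) := by
  simp only [sub_eq_iff_eq_add, zero_add, add_comm i 1]

theorem tokenSurvival_succ_sub (α : ℝ) (n : ℕ) (i a b : ZMod N) :
    tokenSurvival α (n + 1) (a - i) (b - i) =
      if a = i ∧ b = i + 1 ∨ a = i + 1 ∧ b = i then
        α * tokenSurvival α n (a - (i - 1)) (b - (i - 1)) else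
      (1 - (1 - α) / 2) * tokenSurvival α n (a - (i - 1)) (b - (i - 1)) +
        (1 - α) / 2 * tokenSurvival α n (Equiv.swap i (i + 1) a - (i - 1))
          (Equiv.swap i (i + 1) b - (i - 1)) := by
  have h : ∀ a : ZMod N, a - i + 1 = a - (i - 1) := fun a => by ring
  rw [tokenSurvival_succ, tokenStep, swap_sub, swap_sub, h, h]
  exact if_congr (edge_iff i a b) rfl rfl

theorem ofReal_survival_step {α : ℝ} (hα0 : 0 < α) (hα1 : α < 1) {u v : ℝ} (hu : 0 ≤ u)
    (hv : 0 ≤ v) :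
    ENNReal.ofReal ((1 - (1 - α) / 2) * u + (1 - α) / 2 * v) =
      ENNReal.ofReal (1 - (1 - α) / 2) * ENNReal.ofReal u +
        ENNReal.ofReal ((1 - α) / 2) * ENNReal.ofReal v := by
  have h3 : 0 ≤ (1 - α) / 2 := by linarith
  have h4 : 0 ≤ 1 - (1 - α) / 2 := by linarith
  rw [ENNReal.ofReal_add (mul_nonneg h4 hu) (mul_nonneg h3 hv), ENNReal.ofReal_mul h4,
    ENNReal.ofReal_mul h3]

/-- A largest and a smallest value, differing by at least two slots, move like a pair of tokens,
and a compression happens at the latest when the pair is killed. -/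
theorem noCompression_le_tokenSurvival {α Δ : ℝ} (hα0 : 0 < α) (hα1 : α < 1) (hΔ : 0 < Δ)
    (hN : 2 ≤ N) {L : ℕ} (n : ℕ) (i : ZMod N) (z : ZMod N → ℤ) (a b : ZMod N)
    (ha : ∀ k, z k ≤ z a) (hb : ∀ k, z b ≤ z k) (hb0 : 0 ≤ z b) (haL : z a ≤ (L : ℤ) - 1)
    (hab : z b + 2 ≤ z a) :
    ditherLaw Δ (noCompression α Δ L i (scaled Δ z) n) ≤
      ENNReal.ofReal (tokenSurvival α n (a - i) (b - i)) := by
  induction n generalizing i z a b with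
  | zero => rw [ditherLaw_noCompression_zero hΔ, tokenSurvival_zero, ENNReal.ofReal_one]
  | succ n ih =>
    have hi0 : ∀ k, 0 ≤ z k := fun k => hb0.trans (hb k)
    have hiL : ∀ k, z k ≤ (L : ℤ) - 1 := fun k => (ha k).trans haL
    rw [tokenSurvival_succ_sub]
    have hu := tokenSurvival_nonneg hα0 hα1 n (a - (i - 1)) (b - (i - 1))
    have hv := tokenSurvival_nonneg hα0 hα1 n (Equiv.swap i (i + 1) a - (i - 1))
      (Equiv.swap i (i + 1) b - (i - 1))
    have ih1 := ih (i - 1) z a b ha hb hb0 haL hab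
    by_cases hd : |z i - z (i + 1)| ≤ 1
    · rw [if_neg, noCompression_succ_of_abs_le_one hα0 hα1 hΔ hN hd (hi0 _) (hiL _) (hi0 _) (hiL _),
        ofReal_survival_step hα0 hα1 hu hv]
      · gcongr
        apply ih <;> simp [Equiv.swap_apply_self, *]
      · rw [abs_le] at hd
        rintro (⟨rfl, rfl⟩ | ⟨rfl, rfl⟩) <;> omega
    · refine (noCompression_succ_le_of_two_le_abs hα0 hα1 hΔ hN (by omega) (hi0 _) (hiL _) (hi0 _)
        (hiL _) n).trans ?_
      split_ifs
      · rw [ENNReal.ofReal_mul hα0.le]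
        gcongr
      -- The edge carries a pair differing by at least two other than the tracked one. The exchange
      -- term is dropped, and `α ≤ 1 - (1 - α) / 2` covers the other.
      · rw [ofReal_survival_step hα0 hα1 hu hv]
        refine le_trans ?_ le_self_add
        gcongr
        linarith

/-- The slot numbers of the two-outlier configuration. -/
def outlierSlots (ell : ℕ) (a b : ZMod N) : ZMod N → ℤ := fun k =>
  if k = a then (ell : ℤ) + 1 else if k = b then (ell : ℤ) - 1 else ell

theorem twoOutlier_eq_scaled (Δ : ℝ) (ell : ℕ) (a b : ZMod N) :
    twoOutlier Δ ell a b = scaled Δ (outlierSlots ell a b) := by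
  ext k
  simp only [twoOutlier, scaled, outlierSlots]
  split_ifs <;> push_cast <;> rfl

theorem outlierSlots_comp (ell : ℕ) (a b : ZMod N) (σ : Equiv.Perm (ZMod N)) :
    outlierSlots ell a b ∘ σ = outlierSlots ell (σ.symm a) (σ.symm b) := by
  ext k
  simp only [outlierSlots, Function.comp_apply, Equiv.eq_symm_apply]

theorem outlierSlots_mem {ell L : ℕ} (h1 : 1 ≤ ell) (hL : ell + 2 ≤ L) (a b k : ZMod N) :
    0 ≤ outlierSlots ell a b k ∧ outlierSlots ell a b k ≤ (L : ℤ) - 1 := by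
  unfold outlierSlots
  split_ifs <;> omega

/-- The outliers are the only two nodes differing by more than one slot, and they differ by exactly
two, so every step of the comparison with tokens is exact. -/
theorem noCompression_twoOutlier {α Δ : ℝ} (hα0 : 0 < α) (hα1 : α < 1) (hΔ : 0 < Δ)
    (hN : 2 ≤ N) {ell L : ℕ} (h1 : 1 ≤ ell) (hL : ell + 2 ≤ L) (n : ℕ) (i a b : ZMod N)
    (hab : a ≠ b) :
    ditherLaw Δ (noCompression α Δ L i (scaled Δ (outlierSlots ell a b)) n) =
      ENNReal.ofReal (tokenSurvival α n (a - i) (b - i)) := by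
  induction n generalizing i a b with
  | zero => rw [ditherLaw_noCompression_zero hΔ, tokenSurvival_zero, ENNReal.ofReal_one]
  | succ n ih =>
    have hmem := outlierSlots_mem h1 hL a b
    rw [tokenSurvival_succ_sub]
    have hu := tokenSurvival_nonneg hα0 hα1 n (a - (i - 1)) (b - (i - 1))
    have hv := tokenSurvival_nonneg hα0 hα1 n (Equiv.swap i (i + 1) a - (i - 1))
      (Equiv.swap i (i + 1) b - (i - 1))
    have hne := ne_add_one hN i
    split_ifs with he
    · rw [noCompression_succ_of_abs_eq_two hα0 hα1 hΔ hN ?_ (hmem _).1 (hmem _).2 (hmem _).1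
        (hmem _).2, ih _ _ _ hab, ENNReal.ofReal_mul hα0.le]
      rcases he with ⟨rfl, rfl⟩ | ⟨rfl, rfl⟩
      · simp only [outlierSlots, hne.symm, if_true, if_false]
        ring_nf
        simp
      · simp only [outlierSlots, hne, if_true, if_false]
        ring_nf
        simp
    · rw [noCompression_succ_of_abs_le_one hα0 hα1 hΔ hN ?_ (hmem _).1 (hmem _).2 (hmem _).1
        (hmem _).2, ih _ _ _ hab, outlierSlots_comp, Equiv.symm_swap,
        ih _ _ _ (by simpa using hab), ofReal_survival_step hα0 hα1 hu hv]
      unfold outlierSlots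
      rw [abs_le]
      grind

end Tokens

end DitheredDesync

/-! ### Explicit mean lifetime of a pair of tokens -/

namespace DitheredDesync

/-- The leading coefficient of the mean lifetime of a pair of tokens as a function of their gap. -/
noncomputable def gapCurvature (α n : ℝ) : ℝ := n * (1 + α) / (4 * (1 - α))

/-- The constant term of `headTime`. -/
noncomputable def headConst (α n : ℝ) : ℝ :=
  (1 - α + n / 2 - α * n - α * n ^ 2 / 2) / (1 - α)

/-- The mean lifetime of two tokens at positions `1` and `k` on a ring of `n` nodes with active
edge `(0, 1)`. -/
noncomputable def headTime (α n k : ℝ) : ℝ :=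
  -gapCurvature α n * k ^ 2 + (gapCurvature α n * (n + 2) - (n + 1) / 2) * k + headConst α n

/-- The constant term of `tailTime`. -/
noncomputable def tailConst (α n : ℝ) : ℝ :=
  headConst α n - 2 * (1 + (1 - α) / 2 * ((n + 1) * (gapCurvature α n - 1 / 2))) / (1 + α)
    - (n - 1) + (n + 1) * (gapCurvature α n + 1 / 2)

/-- The mean lifetime of two tokens at positions `0` and `k ≠ 1` on a ring of `n` nodes with active
edge `(0, 1)`. -/
noncomputable def tailTime (α n k : ℝ) : ℝ :=
  -gapCurvature α n * k ^ 2 + (gapCurvature α n * n - 1 / 2) * k + tailConst α n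

/-- First-step equation at `(1, k)`: an exchange followed by the shift leads to `(1, k + 1)`.
Otherwise the pair is at `(2, k + 1)` and meets the edge again after `n - k - 1` steps, at `0` and
`n + 1 - k`. -/
theorem headTime_eq {α : ℝ} (hα0 : 0 < α) (hα1 : α < 1) (n k : ℝ) :
    headTime α n k = 1 + (1 - α) / 2 * headTime α n (k + 1) +
      (1 - (1 - α) / 2) * (n - k - 1 + tailTime α n (n + 1 - k)) := by
  have h1 : 1 - α ≠ 0 := by linarith
  have h2 : 1 + α ≠ 0 := by linarith
  simp only [headTime, tailTime, tailConst, headConst, gapCurvature]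
  field_simp
  ring

theorem tailTime_eq {α : ℝ} (hα0 : 0 < α) (hα1 : α < 1) (n k : ℝ) :
    tailTime α n k = 1 + (1 - α) / 2 * (n - k - 1 + tailTime α n (n + 1 - k)) +
      (1 - (1 - α) / 2) * headTime α n (k + 1) := by
  have h1 : 1 - α ≠ 0 := by linarith
  have h2 : 1 + α ≠ 0 := by linarith
  simp only [headTime, tailTime, tailConst, headConst, gapCurvature]
  field_simp
  ring

/-- First-step equation with both tokens on the edge, position `0` being read as `n`. This is where
killing enters. -/
theorem headTime_self {α : ℝ} (hα1 : α < 1) (n : ℝ) :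
    headTime α n n = 1 + α * headTime α n 2 := by
  have h1 : 1 - α ≠ 0 := by linarith
  simp only [headTime, headConst, gapCurvature]
  field_simp
  ring

/-- The mean lifetime of two tokens at positions `x < y`. -/
noncomputable def orderedPairTime (N : ℕ) (α : ℝ) (x y : ℕ) : ℝ :=
  if x = 0 then if y = 1 then headTime α N N else tailTime α N y
  -- If both tokens are off the edge, they advance undisturbed for `N - y` steps, until the one at
  -- `y` wraps around to `0`.
  else if x = 1 then headTime α N y else N - y + tailTime α N (N - y + x)

/-- The mean lifetime of two tokens. -/
noncomputable def pairTime {N : ℕ} (α : ℝ) (x y : ZMod N) : ℝ :=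
  if x.val < y.val then orderedPairTime N α x.val y.val else orderedPairTime N α y.val x.val

section Pair

variable {N : ℕ}

theorem pairTime_comm (α : ℝ) (x y : ZMod N) : pairTime α x y = pairTime α y x := by
  unfold pairTime
  rcases lt_trichotomy x.val y.val with h | h | h
  · rw [if_pos h, if_neg h.not_gt]
  · rw [h]
  · rw [if_neg h.not_gt, if_pos h]

theorem pairTime_natCast (α : ℝ) {m n : ℕ} (hmn : m < n) (hn : n < N) :
    pairTime α (m : ZMod N) (n : ZMod N) = orderedPairTime N α m n := by
  rw [pairTime, ZMod.val_natCast_of_lt hn, ZMod.val_natCast_of_lt (hmn.trans hn), if_pos hmn]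

theorem tokenStep_comm (α : ℝ) {f : ZMod N → ZMod N → ℝ} (hf : ∀ x y, f x y = f y x)
    (x y : ZMod N) : tokenStep α f x y = tokenStep α f y x := by
  unfold tokenStep
  rw [hf (x + 1), hf (Equiv.swap 0 1 x + 1)]
  refine if_congr ?_ rfl rfl
  tauto

theorem natCast_ne (hN : 2 ≤ N) {b : ℕ} (hb : 2 ≤ b) (hbN : b < N) :
    (b : ZMod N) ≠ 0 ∧ (b : ZMod N) ≠ 1 := by
  constructor
  · intro h
    have := congrArg ZMod.val h
    rw [ZMod.val_natCast_of_lt hbN, ZMod.val_zero] at this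
    omega
  · intro h
    have h1 : (b : ZMod N) = ((1 : ℕ) : ZMod N) := by rw [h, Nat.cast_one]
    have := congrArg ZMod.val h1
    rw [ZMod.val_natCast_of_lt hbN, ZMod.val_natCast_of_lt (by omega)] at this
    omega

/-- One formula also covers the wrap-around `b + 1 = N`, because `orderedPairTime` uses `headTime`
at `N` for the positions `0` and `1`. -/
theorem pairTime_one_succ {α : ℝ} {b : ℕ} (hb : 2 ≤ b) (hbN : b < N) :
    pairTime α (1 : ZMod N) ((b : ZMod N) + 1) = headTime α N (b + 1) := by
  rcases Nat.lt_or_ge (b + 1) N with h | h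
  · have := pairTime_natCast (N := N) α (show 1 < b + 1 by omega) h
    simpa [orderedPairTime] using this
  · have hb1 : N = b + 1 := by omega
    have h0 : (b : ZMod N) + 1 = ((0 : ℕ) : ZMod N) := by
      rw [← Nat.cast_one, ← Nat.cast_add, ← hb1]
      simp
    have := pairTime_natCast (N := N) α (show 0 < 1 by omega) (by omega)
    rw [h0, pairTime_comm, show (1 : ZMod N) = ((1 : ℕ) : ZMod N) by simp, this]
    simp only [orderedPairTime, if_true]
    rw [hb1]
    push_cast
    rfl

theorem pairTime_succ_succ {α : ℝ} {a b : ℕ} (ha : 1 ≤ a) (hab : a < b) (hbN : b < N) :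
    pairTime α ((a : ZMod N) + 1) ((b : ZMod N) + 1) =
      N - b - 1 + tailTime α N (N - b + a) := by
  rcases Nat.lt_or_ge (b + 1) N with h | h
  · have := pairTime_natCast (N := N) α (show a + 1 < b + 1 by omega) h
    push_cast at this
    rw [this, orderedPairTime, if_neg (by omega), if_neg (by omega)]
    push_cast
    ring_nf
  · have hb1 : N = b + 1 := by omega
    have h0 : (b : ZMod N) + 1 = ((0 : ℕ) : ZMod N) := by
      rw [← Nat.cast_one, ← Nat.cast_add, ← hb1]
      simp
    have := pairTime_natCast (N := N) α (show 0 < a + 1 by omega) (by omega)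
    rw [h0, pairTime_comm, show (a : ZMod N) + 1 = ((a + 1 : ℕ) : ZMod N) by simp, this,
      orderedPairTime, if_pos rfl, if_neg (by omega)]
    rw [hb1]
    push_cast
    ring_nf

theorem pairTime_eq [NeZero N] (hN : 2 ≤ N) {α : ℝ} (hα0 : 0 < α) (hα1 : α < 1) (x y : ZMod N)
    (hxy : x ≠ y) : pairTime α x y = 1 + tokenStep α (pairTime α) x y := by
  wlog hlt : x.val < y.val generalizing x y
  · have hlt' : y.val < x.val :=
      lt_of_le_of_ne (not_lt.1 hlt) fun h => hxy (ZMod.val_injective N h.symm)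
    rw [pairTime_comm, tokenStep_comm α (pairTime_comm α)]
    exact this y x hxy.symm hlt'
  obtain ⟨a, b, hab, hb, rfl, rfl⟩ : ∃ a b : ℕ, a < b ∧ b < N ∧ x = a ∧ y = b :=
    ⟨x.val, y.val, hlt, ZMod.val_lt y, by simp, by simp⟩
  rw [pairTime_natCast α hab hb]
  rcases Nat.lt_or_ge b 2 with hb2 | hb2
  · obtain rfl : a = 0 := by omega
    obtain rfl : b = 1 := by omega
    rw [tokenStep, if_pos (by simp), orderedPairTime, if_pos rfl, if_pos rfl, headTime_self hα1]
    congr 2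
    push_cast
    rw [zero_add]
    rcases Nat.lt_or_ge 2 N with h | h
    · have := pairTime_natCast (N := N) α (show 1 < 2 by omega) h
      simp only [orderedPairTime] at this
      push_cast at this
      rw [one_add_one_eq_two, this]
    -- On two nodes the shifted edge is the same pair of nodes, and `headTime` at `2` is also its
    -- value at `N`.
    · obtain rfl : N = 2 := by omega
      have := pairTime_natCast (N := 2) α (show 0 < 1 by omega) (by omega)
      rw [pairTime_comm, show (1 + 1 : ZMod 2) = 0 from rfl]
      simpa [orderedPairTime] using this.symm
  · obtain ⟨hb0, hb1⟩ := natCast_ne hN hb2 hb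
    rw [tokenStep, if_neg (by tauto), Equiv.swap_apply_of_ne_of_ne hb0 hb1]
    obtain rfl | rfl | ha2 : a = 0 ∨ a = 1 ∨ 2 ≤ a := by omega
    · have h2 := pairTime_succ_succ (α := α) le_rfl (show 1 < b by omega) hb
      push_cast at h2 ⊢
      rw [Equiv.swap_apply_left, zero_add, pairTime_one_succ hb2 hb, h2, orderedPairTime,
        if_pos rfl, if_neg (by omega), tailTime_eq hα0 hα1]
      ring_nf
    · have h2 := pairTime_succ_succ (α := α) le_rfl (show 1 < b by omega) hb
      push_cast at h2 ⊢
      rw [Equiv.swap_apply_right, zero_add, pairTime_one_succ hb2 hb, h2, orderedPairTime,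
        if_neg (by omega), if_pos rfl, headTime_eq hα0 hα1]
      ring_nf
    · obtain ⟨ha0, ha1⟩ := natCast_ne hN ha2 (hab.trans hb)
      rw [Equiv.swap_apply_of_ne_of_ne ha0 ha1, pairTime_succ_succ (by omega) hab hb,
        orderedPairTime, if_neg (by omega), if_neg (by omega)]
      ring

/-! ### Summing the lifetime over all pairs -/

theorem sum_zmod_eq_sum_range {M : Type*} [AddCommMonoid M] [NeZero N] (f : ZMod N → M) :
    ∑ x, f x = ∑ m ∈ Finset.range N, f (m : ZMod N) := by
  refine Finset.sum_nbij' (fun x => x.val) (fun m => (m : ZMod N)) ?_ ?_ ?_ ?_ ?_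
  · intro x _
    exact Finset.mem_range.2 (ZMod.val_lt x)
  · intro m _
    exact Finset.mem_univ _
  · intro x _
    simp
  · intro m hm
    exact ZMod.val_natCast_of_lt (Finset.mem_range.1 hm)
  · intro x _
    simp

theorem sum_offDiag_of_comm (g : ℕ → ℕ → ℝ) (hg : ∀ m n, g m n = g n m) (n : ℕ) :
    ∑ x ∈ Finset.range n, ∑ y ∈ Finset.range n, (if x ≠ y then g x y else 0) =
      2 * ∑ y ∈ Finset.range n, ∑ x ∈ Finset.range y, g x y := by
  induction n with
  | zero => simp
  | succ n ih =>
    have h1 : ∀ x ∈ Finset.range n, (if x ≠ n then g x n else 0) = g x n := by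
      intro x hx
      rw [if_pos (Finset.mem_range.1 hx).ne]
    have h2 : ∀ x ∈ Finset.range n, (if n ≠ x then g n x else 0) = g x n := by
      intro x hx
      rw [if_pos (Finset.mem_range.1 hx).ne', hg]
    simp only [Finset.sum_range_succ, Finset.sum_add_distrib]
    rw [ih, Finset.sum_congr rfl h1, Finset.sum_congr rfl h2, if_neg (by simp)]
    ring

theorem sum_range_cubic (c₀ c₁ c₂ c₃ : ℝ) (n : ℕ) :
    ∑ j ∈ Finset.range n, (c₀ + c₁ * j + c₂ * (j : ℝ) ^ 2 + c₃ * (j : ℝ) ^ 3) =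
      c₀ * n + c₁ * (n * (n - 1) / 2) + c₂ * ((n - 1) * n * (2 * n - 1) / 6) +
        c₃ * (n * (n - 1) / 2) ^ 2 := by
  induction n with
  | zero => simp
  | succ n ih =>
    rw [Finset.sum_range_succ, ih]
    push_cast
    ring

theorem sum_orderedPairTime (α : ℝ) (N j : ℕ) :
    ∑ x ∈ Finset.range (j + 2), orderedPairTime N α x (j + 2) =
      tailTime α N (j + 2) + headTime α N (j + 2) +
        ∑ l ∈ Finset.range j, (N - (j + 2) + tailTime α N (N - j + l)) := by
  rw [Finset.sum_range_succ', Finset.sum_range_succ']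
  have h0 : orderedPairTime N α 0 (j + 2) = tailTime α N (j + 2) := by simp [orderedPairTime]
  have h1 : orderedPairTime N α (0 + 1) (j + 2) = headTime α N (j + 2) := by
    simp [orderedPairTime]
  have h2 : ∀ l : ℕ, orderedPairTime N α (l + 1 + 1) (j + 2) =
      N - (j + 2) + tailTime α N (N - j + l) := by
    intro l
    rw [orderedPairTime, if_neg (by omega), if_neg (by omega)]
    push_cast
    ring_nf
  rw [h0, h1, Finset.sum_congr rfl fun l _ => h2 l]
  ring

theorem sum_pairTime [NeZero N] (hN : 2 ≤ N) {α : ℝ} (hα0 : 0 < α) (hα1 : α < 1) :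
    ∑ x : ZMod N, ∑ y : ZMod N, (if x ≠ y then pairTime α x y else 0) =
      ((N * (N - 1) : ℕ) : ℝ) * closedForm N α := by
  have h1 : ∑ x : ZMod N, ∑ y : ZMod N, (if x ≠ y then pairTime α x y else 0) =
      ∑ x ∈ Finset.range N, ∑ y ∈ Finset.range N,
        (if x ≠ y then pairTime α (x : ZMod N) (y : ZMod N) else 0) := by
    rw [sum_zmod_eq_sum_range]
    refine Finset.sum_congr rfl fun x hx => ?_
    rw [sum_zmod_eq_sum_range]
    refine Finset.sum_congr rfl fun y hy => if_congr (not_congr ?_) rfl rfl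
    rw [ZMod.natCast_eq_natCast_iff', Nat.mod_eq_of_lt (Finset.mem_range.1 hx),
      Nat.mod_eq_of_lt (Finset.mem_range.1 hy)]
  rw [h1, sum_offDiag_of_comm (fun m n => pairTime α (m : ZMod N) (n : ZMod N))
    fun m n => pairTime_comm α _ _]
  have h2 : ∑ y ∈ Finset.range N, ∑ x ∈ Finset.range y, pairTime α (x : ZMod N) (y : ZMod N) =
      ∑ y ∈ Finset.range N, ∑ x ∈ Finset.range y, orderedPairTime N α x y :=
    Finset.sum_congr rfl fun y hy => Finset.sum_congr rfl fun x hx =>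
      pairTime_natCast α (Finset.mem_range.1 hx) (Finset.mem_range.1 hy)
  rw [h2]
  obtain ⟨M, rfl⟩ : ∃ M, N = M + 2 := ⟨N - 2, by omega⟩
  -- The inner sum over the smaller position is a cubic polynomial in `j`; its coefficients are
  -- collected so that `sum_range_cubic` applies to the outer sum.
  have h3 : ∀ j : ℕ, ∑ x ∈ Finset.range (j + 2), orderedPairTime (M + 2) α x (j + 2) =
      (-8 * gapCurvature α (M + 2) + 2 * ((gapCurvature α (M + 2) * (M + 2 + 2) - (M + 2 + 1) / 2) +
          (gapCurvature α (M + 2) * (M + 2) - 1 / 2)) + headConst α (M + 2) +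
          tailConst α (M + 2)) +
        (M + 2 - 2 - gapCurvature α (M + 2) * (M + 2) ^ 2 +
          (gapCurvature α (M + 2) * (M + 2) - 1 / 2) * (M + 2) + tailConst α (M + 2) -
          (gapCurvature α (M + 2) * (M + 2) - 1 / 2 - 2 * gapCurvature α (M + 2) * (M + 2)) / 2 -
          gapCurvature α (M + 2) / 6 - 8 * gapCurvature α (M + 2) +
          (gapCurvature α (M + 2) * (M + 2 + 2) - (M + 2 + 1) / 2) +
          (gapCurvature α (M + 2) * (M + 2) - 1 / 2)) * j +
        (-1 + gapCurvature α (M + 2) * (M + 2) - (gapCurvature α (M + 2) * (M + 2) - 1 / 2) / 2 -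
          5 * gapCurvature α (M + 2) / 2) * (j : ℝ) ^ 2 +
        (-gapCurvature α (M + 2) / 3) * (j : ℝ) ^ 3 := by
    intro j
    rw [sum_orderedPairTime]
    have h4 : ∀ l : ℕ, ((M + 2 : ℕ) : ℝ) - (j + 2) + tailTime α (M + 2 : ℕ) ((M + 2 : ℕ) - j + l) =
        (M + 2 - (j + 2) + tailTime α (M + 2) (M + 2 - j)) +
          (gapCurvature α (M + 2) * (M + 2) - 1 / 2 -
            2 * gapCurvature α (M + 2) * (M + 2 - j)) * l +
          (-gapCurvature α (M + 2)) * (l : ℝ) ^ 2 + 0 * (l : ℝ) ^ 3 := by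
      intro l
      simp only [tailTime]
      push_cast
      ring
    simp only [h4]
    rw [sum_range_cubic]
    simp only [tailTime, headTime]
    push_cast
    ring
  rw [Finset.sum_range_succ', Finset.sum_range_succ']
  simp only [Nat.add_assoc, Nat.reduceAdd, h3]
  rw [sum_range_cubic]
  have h5 : 1 - α ≠ 0 := by linarith
  have h6 : 1 + α ≠ 0 := by linarith
  have h7 : (M : ℝ) + 2 ≠ 0 := by positivity
  simp only [Finset.sum_range_one, Finset.sum_range_zero, orderedPairTime, if_true,
    headTime, tailConst, headConst, gapCurvature, closedForm]
  rw [show (M + 2) * (M + 2 - 1) = (M + 2) * (M + 1) from rfl]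
  push_cast
  field_simp
  ring

/-! ### Uniform upper bounds on the lifetime -/

theorem gapCurvature_ge {α n : ℝ} (hα0 : 0 < α) (hα1 : α < 1) (hn : 2 ≤ n) :
    1 / 2 ≤ gapCurvature α n := by
  have h1 : 0 < 1 - α := by linarith
  rw [gapCurvature, div_le_div_iff₀ (by norm_num) (by linarith)]
  nlinarith

/-- With the factor six this amounts to `4 ≤ (1 + α) * n ^ 2`, which `n ≥ 2` guarantees. -/
theorem le_growth {α n : ℝ} (hα0 : 0 < α) (hα1 : α < 1) (hn : 2 ≤ n) :
    n / (1 - α) ≤ 6 * (gConst α * n ^ 3) := by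
  have h1 : 0 < 1 - α := by linarith
  rw [gConst, div_mul_eq_mul_div, ← mul_div_assoc, div_le_div_iff₀ h1 (by linarith)]
  have h2 : 4 * n ≤ (α + 1) * n ^ 3 := by
    have : 4 * n ≤ n ^ 3 := by
      have h3 : 4 ≤ n ^ 2 := by nlinarith
      nlinarith [mul_le_mul_of_nonneg_right h3 (show 0 ≤ n by linarith)]
    nlinarith [pow_pos (show 0 < n by linarith) 3]
  nlinarith

theorem headConst_le {α n : ℝ} (hα0 : 0 < α) (hα1 : α < 1) (hn : 2 ≤ n) :
    headConst α n ≤ 6 * (gConst α * n ^ 3) := by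
  refine le_trans ?_ (le_growth hα0 hα1 hn)
  have h1 : 0 < 1 - α := by linarith
  rw [headConst, div_le_div_iff_of_pos_right h1]
  nlinarith [mul_pos hα0 (show 0 < n by linarith)]

theorem gapCurvature_mul_sq {α n : ℝ} (hα1 : α < 1) :
    gapCurvature α n * n ^ 2 = 6 * (gConst α * n ^ 3) := by
  have h1 : 1 - α ≠ 0 := by linarith
  rw [gapCurvature, gConst]
  field_simp
  ring

theorem headTime_le {α n k : ℝ} (hα0 : 0 < α) (hα1 : α < 1) (hn : 2 ≤ n) (hk0 : 0 ≤ k)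
    (hkn : k ≤ n) : headTime α n k ≤ 18 * (gConst α * n ^ 3) := by
  have hA := gapCurvature_ge hα0 hα1 hn
  have h1 := headConst_le hα0 hα1 hn
  have h2 := gapCurvature_mul_sq (n := n) hα1
  have h3 : gapCurvature α n * (n + 2) * k ≤ gapCurvature α n * (2 * n) * n := by
    gcongr
    linarith
  rw [headTime]
  nlinarith [mul_nonneg (show 0 ≤ gapCurvature α n by linarith) (sq_nonneg k),
    mul_nonneg (show 0 ≤ n + 1 by linarith) hk0]

theorem tailTime_le {α n k : ℝ} (hα0 : 0 < α) (hα1 : α < 1) (hn : 2 ≤ n) (hk0 : 0 ≤ k)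
    (hkn : k ≤ n) : tailTime α n k ≤ 24 * (gConst α * n ^ 3) := by
  have hA := gapCurvature_ge hα0 hα1 hn
  have h1 := headConst_le hα0 hα1 hn
  have h2 := gapCurvature_mul_sq (n := n) hα1
  have h3 : gapCurvature α n * n * k ≤ gapCurvature α n * n * n := by gcongr
  have h4 : 0 ≤ 2 * (1 + (1 - α) / 2 * ((n + 1) * (gapCurvature α n - 1 / 2))) / (1 + α) := by
    have : 0 ≤ (1 - α) / 2 * ((n + 1) * (gapCurvature α n - 1 / 2)) :=
      mul_nonneg (by linarith) (mul_nonneg (by linarith) (by linarith))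
    positivity
  have h5 : (n + 1) * (gapCurvature α n + 1 / 2) ≤ 2 * (gapCurvature α n * n ^ 2) := by
    nlinarith [mul_nonneg (sub_nonneg.2 hA) (sub_nonneg.2 hn)]
  rw [tailTime, tailConst]
  nlinarith [mul_nonneg (show 0 ≤ gapCurvature α n by linarith) (sq_nonneg k)]

theorem pairTime_le [NeZero N] (hN : 2 ≤ N) {α : ℝ} (hα0 : 0 < α) (hα1 : α < 1) {x y : ZMod N}
    (hxy : x ≠ y) : pairTime α x y ≤ 30 * (gConst α * (N : ℝ) ^ 3) := by
  wlog hlt : x.val < y.val generalizing x y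
  · have hlt' : y.val < x.val :=
      lt_of_le_of_ne (not_lt.1 hlt) fun h => hxy (ZMod.val_injective N h.symm)
    rw [pairTime_comm]
    exact this hxy.symm hlt'
  have hn : (2 : ℝ) ≤ N := by exact_mod_cast hN
  have hy : (y.val : ℝ) < N := by exact_mod_cast ZMod.val_lt y
  have hx : (x.val : ℝ) < y.val := by exact_mod_cast hlt
  have hx0 : (0 : ℝ) ≤ x.val := Nat.cast_nonneg _
  have hgrow := le_growth hα0 hα1 hn
  have hX : (N : ℝ) ≤ N / (1 - α) := by
    rw [le_div_iff₀ (by linarith)]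
    nlinarith
  rw [pairTime, if_pos hlt, orderedPairTime]
  -- The constant 30 is 24 from `tailTime_le` plus 6 for the waiting time `N - y ≤ N / (1 - α)` of
  -- the last case.
  split_ifs
  · linarith [headTime_le hα0 hα1 hn (show (0 : ℝ) ≤ N by linarith) le_rfl]
  · linarith [tailTime_le hα0 hα1 hn (show (0 : ℝ) ≤ y.val by linarith) hy.le]
  · linarith [headTime_le hα0 hα1 hn (show (0 : ℝ) ≤ y.val by linarith) hy.le]
  · linarith [tailTime_le hα0 hα1 hn (show (0 : ℝ) ≤ N - y.val + x.val by linarith)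
      (by linarith)]

theorem pairTime_nonneg [NeZero N] (hN : 2 ≤ N) {α : ℝ} (hα0 : 0 < α) (hα1 : α < 1) {x y : ZMod N}
    (hxy : x ≠ y) : 0 ≤ pairTime α x y :=
  (hasSum_tokenSurvival hα0 hα1 (pairTime_eq hN hα0 hα1) hxy).nonneg
    fun n => tokenSurvival_nonneg hα0 hα1 n x y

end Pair

end DitheredDesync

/-! ### Worst case and averages over placements -/

namespace DitheredDesync

section Main

variable {N : ℕ}

theorem tsum_ofReal_tokenSurvival [NeZero N] (hN : 2 ≤ N) {α : ℝ} (hα0 : 0 < α) (hα1 : α < 1)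
    {x y : ZMod N} (hxy : x ≠ y) :
    ∑' n, ENNReal.ofReal (tokenSurvival α n x y) = ENNReal.ofReal (pairTime α x y) := by
  have h := hasSum_tokenSurvival hα0 hα1 (pairTime_eq hN hα0 hα1) hxy
  rw [← ENNReal.ofReal_tsum_of_nonneg (fun n => tokenSurvival_nonneg hα0 hα1 n x y) h.summable,
    h.tsum_eq]

theorem meanTime_scaled_le [NeZero N] {α Δ : ℝ} (hα0 : 0 < α) (hα1 : α < 1) (hΔ : 0 < Δ)
    (hN : 2 ≤ N) {L : ℕ} (i : ZMod N) {z : ZMod N → ℤ} {a b : ZMod N}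
    (ha : ∀ k, z k ≤ z a) (hb : ∀ k, z b ≤ z k) (hb0 : 0 ≤ z b) (haL : z a ≤ (L : ℤ) - 1)
    (hab : z b + 2 ≤ z a) :
    meanTime α Δ L i (scaled Δ z) ≤ ENNReal.ofReal (pairTime α (a - i) (b - i)) := by
  have hne : a - i ≠ b - i := by
    intro h
    rw [sub_left_inj] at h
    subst h
    omega
  rw [meanTime_eq_tsum, ← tsum_ofReal_tokenSurvival hN hα0 hα1 hne]
  exact ENNReal.tsum_le_tsum fun n =>
    noCompression_le_tokenSurvival hα0 hα1 hΔ hN n i z a b ha hb hb0 haL hab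

theorem meanTime_twoOutlier [NeZero N] {α Δ : ℝ} (hα0 : 0 < α) (hα1 : α < 1) (hΔ : 0 < Δ)
    (hN : 2 ≤ N) {ell L : ℕ} (h1 : 1 ≤ ell) (hL : ell + 2 ≤ L) (i : ZMod N) {a b : ZMod N}
    (hab : a ≠ b) :
    meanTime α Δ L i (twoOutlier Δ ell a b) = ENNReal.ofReal (pairTime α (a - i) (b - i)) := by
  rw [meanTime_eq_tsum, ← tsum_ofReal_tokenSurvival hN hα0 hα1 (by simpa using hab),
    twoOutlier_eq_scaled]
  simp only [noCompression_twoOutlier hα0 hα1 hΔ hN h1 hL _ i a b hab]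

/-- A state that is not TDM has two values that differ by at least two slots. -/
theorem exists_slots_of_mem_unsettled [NeZero N] {Δ : ℝ} (hΔ : 0 < Δ) {L : ℕ} {q : ZMod N → ℝ}
    (hq : q ∈ unsettled N Δ L) :
    ∃ (z : ZMod N → ℤ) (a b : ZMod N), q = scaled Δ z ∧ (∀ k, z k ≤ z a) ∧ (∀ k, z b ≤ z k) ∧
      0 ≤ z b ∧ z a ≤ (L : ℤ) - 1 ∧ z b + 2 ≤ z a := by
  obtain ⟨⟨hslot, -, hsum⟩, htdm⟩ := hq
  choose j hjL hj using hslot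
  obtain ⟨a, ha⟩ := Finite.exists_max j
  obtain ⟨b, hb⟩ := Finite.exists_min j
  refine ⟨fun k => j k, a, b, ?_, fun k => Int.ofNat_le.2 (ha k),
    fun k => Int.ofNat_le.2 (hb k), Int.natCast_nonneg _, ?_, ?_⟩
  · ext k
    simp [scaled, hj]
  · have := hjL a
    change (j a : ℤ) ≤ _
    omega
  by_contra hlt
  change ¬ (j b : ℤ) + 2 ≤ j a at hlt
  apply htdm
  have hcase : ∀ k, j k = j b + if j k = j b + 1 then 1 else 0 := by
    intro k
    have h1 := ha k
    have h2 := hb k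
    split_ifs <;> omega
  have hsumj : ∑ k, j k = L := by
    simp only [hj, ← Finset.sum_mul] at hsum
    exact_mod_cast mul_right_cancel₀ hΔ.ne' hsum
  set c := (Finset.univ.filter fun k => j k = j b + 1).card with hc
  -- If all values are the minimum or one more, this is division of `L` by `N` with remainder: `c <
  -- N` since the minimal node is not counted. Hence the state would be TDM.
  have hL : L = c + N * j b := by
    rw [← hsumj, Finset.sum_congr rfl fun k _ => hcase k, Finset.sum_add_distrib,
      Finset.sum_const, Finset.card_univ, ZMod.card, hc, Finset.card_filter, smul_eq_mul, add_comm]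
  have hcN : c < N := by
    have : c < (Finset.univ : Finset (ZMod N)).card :=
      Finset.card_lt_card (Finset.filter_ssubset.2 ⟨b, Finset.mem_univ b, by omega⟩)
    rwa [Finset.card_univ, ZMod.card] at this
  have hdiv : L / N = j b := by
    rw [hL, Nat.add_mul_div_left _ _ (by omega), Nat.div_eq_of_lt hcN, zero_add]
  have hmod : L % N = c := by
    rw [hL, Nat.add_mul_mod_self_left, Nat.mod_eq_of_lt hcN]
  have hiff : ∀ k, q k = ((L / N : ℕ) + 1 : ℝ) * Δ ↔ j k = j b + 1 := by
    intro k
    rw [hj, hdiv, mul_left_inj' hΔ.ne']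
    exact_mod_cast Iff.rfl
  refine ⟨?_, fun k hk => ?_⟩
  · rw [hmod, hc]
    congr 1
    ext k
    simp only [Finset.mem_filter, Finset.mem_univ, true_and, hiff]
  · rw [Ne, hiff] at hk
    have := hcase k
    rw [if_neg hk, add_zero] at this
    rw [hj, hdiv, this]

/-- Keeps the top value `ell + 1` at most `L - 1`, so it is an admissible slot number. -/
theorem add_two_le_mul {ell : ℕ} (hN : 2 ≤ N) (hell : 2 ≤ ell) : ell + 2 ≤ ell * N := by
  nlinarith

theorem twoOutlier_mem_unsettled [NeZero N] {Δ : ℝ} (hΔ : 0 < Δ) (hN : 2 ≤ N) {ell : ℕ}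
    (hell : 2 ≤ ell) {a b : ZMod N} (hab : a ≠ b) :
    twoOutlier Δ ell a b ∈ unsettled N Δ (ell * N) := by
  have hL := add_two_le_mul hN hell
  have hcast : (2 : ℝ) ≤ ell := by exact_mod_cast hell
  refine ⟨⟨fun k => ?_, fun k => ?_, ?_⟩, ?_⟩
  · refine ⟨(outlierSlots ell a b k).toNat, ?_, ?_⟩
    · have := (outlierSlots_mem (by omega) hL a b k)
      omega
    · have h := (outlierSlots_mem (by omega) hL a b k).1
      have : (((outlierSlots ell a b k).toNat : ℤ) : ℝ) = outlierSlots ell a b k := by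
        rw [Int.toNat_of_nonneg h]
      rw [twoOutlier_eq_scaled, scaled, ← this, Int.cast_natCast]
  · unfold twoOutlier
    split_ifs <;> nlinarith
  · have h : ∀ k, twoOutlier Δ ell a b k =
        ((ell : ℝ) + (if k = a then 1 else 0) - (if k = b then 1 else 0)) * Δ := by
      intro k
      unfold twoOutlier
      split_ifs with h1 h2
      · exact absurd (h1.symm.trans h2) hab
      all_goals ring
    simp only [h, ← Finset.sum_mul, Finset.sum_sub_distrib, Finset.sum_add_distrib,
      Finset.sum_ite_eq', Finset.mem_univ, if_true, Finset.sum_const, Finset.card_univ, ZMod.card,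
      nsmul_eq_mul]
    push_cast
    ring
  · rintro ⟨hcard, -⟩
    rw [Nat.mul_mod_left, Finset.card_eq_zero] at hcard
    have : a ∈ (∅ : Finset (ZMod N)) := by
      rw [← hcard, Finset.mem_filter]
      refine ⟨Finset.mem_univ a, ?_⟩
      rw [Nat.mul_div_cancel _ (by omega), twoOutlier, if_pos rfl]
    simp at this

theorem exists_perm_apply_eq {X : Type*} [DecidableEq X] {a b x y : X} (hab : a ≠ b)
    (hxy : x ≠ y) : ∃ π : Equiv.Perm X, π a = x ∧ π b = y := by
  refine ⟨Equiv.swap (Equiv.swap a x b) y * Equiv.swap a x, ?_, ?_⟩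
  · rw [Equiv.Perm.mul_apply, Equiv.swap_apply_left, Equiv.swap_apply_of_ne_of_ne _ hxy]
    intro h
    have := congrArg (Equiv.swap a x) h
    rw [Equiv.swap_apply_self, Equiv.swap_apply_right] at this
    exact hab this
  · rw [Equiv.Perm.mul_apply, Equiv.swap_apply_left]

/-- Averaging over permutations is averaging over ordered pairs of distinct points. -/
theorem sum_perm_apply_apply {X : Type*} [Fintype X] [DecidableEq X] (f : X → X → ℝ≥0∞)
    {a b : X} (hab : a ≠ b) :
    ((Fintype.card X * (Fintype.card X - 1) : ℕ) : ℝ≥0∞) * ∑ σ : Equiv.Perm X, f (σ a) (σ b) =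
      ((Fintype.card X).factorial : ℝ≥0∞) * ∑ x, ∑ y, (if x ≠ y then f x y else 0) := by
  set T := ∑ σ : Equiv.Perm X, f (σ a) (σ b) with hT
  -- By double transitivity, right multiplication carries any ordered pair to `(a, b)`; summing over
  -- all pairs and exchanging sums then gives the claim.
  have hconst : ∀ x y, x ≠ y → ∑ σ : Equiv.Perm X, f (σ x) (σ y) = T := by
    intro x y hxy
    obtain ⟨π, rfl, rfl⟩ := exists_perm_apply_eq hab hxy
    exact Equiv.sum_comp (Equiv.mulRight π) fun σ : Equiv.Perm X => f (σ a) (σ b)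
  have h1 : ∑ x : X, ∑ y : X, ∑ σ : Equiv.Perm X, (if x ≠ y then f (σ x) (σ y) else 0) =
      ((Fintype.card X * (Fintype.card X - 1) : ℕ) : ℝ≥0∞) * T := by
    have h2 : ∀ x y : X, ∑ σ : Equiv.Perm X, (if x ≠ y then f (σ x) (σ y) else 0) =
        if x ≠ y then T else 0 := by
      intro x y
      split_ifs with h
      · exact hconst x y h
      · simp
    simp only [h2]
    have h3 : ∀ x : X, ∑ y : X, (if x ≠ y then T else 0) = (Fintype.card X - 1 : ℕ) * T := by
      intro x
      rw [← Finset.sum_filter, Finset.sum_const, nsmul_eq_mul, Finset.filter_ne,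
        Finset.card_erase_of_mem (Finset.mem_univ x), Finset.card_univ]
    simp only [h3, Finset.sum_const, Finset.card_univ, nsmul_eq_mul]
    push_cast
    ring
  have h4 : ∑ x : X, ∑ y : X, ∑ σ : Equiv.Perm X, (if x ≠ y then f (σ x) (σ y) else 0) =
      ∑ σ : Equiv.Perm X, ∑ x : X, ∑ y : X, (if x ≠ y then f x y else 0) := by
    have h5 : ∀ σ : Equiv.Perm X, ∑ x : X, ∑ y : X, (if x ≠ y then f x y else 0) =
        ∑ x : X, ∑ y : X, (if x ≠ y then f (σ x) (σ y) else 0) := by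
      intro σ
      rw [← Equiv.sum_comp σ]
      refine Finset.sum_congr rfl fun x _ => ?_
      rw [← Equiv.sum_comp σ]
      refine Finset.sum_congr rfl fun y _ => if_congr ?_ rfl rfl
      simp
    rw [Finset.sum_congr rfl fun σ _ => h5 σ]
    exact Eq.trans (Finset.sum_congr rfl fun x _ => Finset.sum_comm) Finset.sum_comm
  rw [← h1, h4, Finset.sum_const, Finset.card_univ, Fintype.card_perm, nsmul_eq_mul]

theorem sum_ofReal_pairTime [NeZero N] (hN : 2 ≤ N) {α : ℝ} (hα0 : 0 < α) (hα1 : α < 1)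
    (i : ZMod N) :
    ∑ x : ZMod N, ∑ y : ZMod N,
        (if x ≠ y then ENNReal.ofReal (pairTime α (x - i) (y - i)) else 0) =
      ((N * (N - 1) : ℕ) : ℝ≥0∞) * ENNReal.ofReal (closedForm N α) := by
  have h1 : ∑ x : ZMod N, ∑ y : ZMod N,
      (if x ≠ y then ENNReal.ofReal (pairTime α (x - i) (y - i)) else 0) =
      ∑ x : ZMod N, ∑ y : ZMod N, ENNReal.ofReal (if x ≠ y then pairTime α x y else 0) := by
    rw [← Equiv.sum_comp (Equiv.subRight i)
      (fun x => ∑ y : ZMod N, ENNReal.ofReal (if x ≠ y then pairTime α x y else 0))]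
    refine Finset.sum_congr rfl fun x _ => ?_
    refine Eq.trans (Finset.sum_congr rfl fun y _ => ?_) (Equiv.sum_comp (Equiv.subRight i)
      fun y => ENNReal.ofReal (if x - i ≠ y then pairTime α (x - i) y else 0))
    by_cases h : x = y <;> simp [h]
  have hnn : ∀ x y : ZMod N, 0 ≤ if x ≠ y then pairTime α x y else 0 := by
    intro x y
    split_ifs with hxy
    exacts [pairTime_nonneg hN hα0 hα1 hxy, le_rfl]
  have h2 : ∀ x : ZMod N, ∑ y : ZMod N, ENNReal.ofReal (if x ≠ y then pairTime α x y else 0) =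
      ENNReal.ofReal (∑ y : ZMod N, if x ≠ y then pairTime α x y else 0) := fun x =>
    (ENNReal.ofReal_sum_of_nonneg fun y _ => hnn x y).symm
  rw [h1, Finset.sum_congr rfl fun x _ => h2 x,
    ← ENNReal.ofReal_sum_of_nonneg fun x _ => Finset.sum_nonneg fun y _ => hnn x y,
    sum_pairTime hN hα0 hα1, ENNReal.ofReal_mul (Nat.cast_nonneg _), ENNReal.ofReal_natCast]

theorem natCast_mul_pred_ne_zero (hN : 2 ≤ N) : ((N * (N - 1) : ℕ) : ℝ≥0∞) ≠ 0 := by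
  have : 0 < N * (N - 1) := Nat.mul_pos (by omega) (by omega)
  exact_mod_cast this.ne'

/-- The inverse appears because the value of `q` at `a` sits at `σ.symm a` in `q ∘ σ`. -/
theorem perm_average_pairTime [NeZero N] (hN : 2 ≤ N) {α : ℝ} (hα0 : 0 < α) (hα1 : α < 1)
    (i : ZMod N) {a b : ZMod N} (hab : a ≠ b) :
    (∑ σ : Equiv.Perm (ZMod N), ENNReal.ofReal (pairTime α (σ.symm a - i) (σ.symm b - i))) /
      (N.factorial : ℝ≥0∞) = ENNReal.ofReal (closedForm N α) := by
  have h := sum_perm_apply_apply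
    (fun x y : ZMod N => ENNReal.ofReal (pairTime α (x - i) (y - i))) hab
  rw [sum_ofReal_pairTime hN hα0 hα1, ZMod.card, mul_left_comm] at h
  have h1 := (ENNReal.mul_right_inj (natCast_mul_pred_ne_zero hN) (ENNReal.natCast_ne_top _)).1 h
  have h2 : ∑ σ : Equiv.Perm (ZMod N), ENNReal.ofReal (pairTime α (σ.symm a - i) (σ.symm b - i)) =
      ∑ σ : Equiv.Perm (ZMod N), ENNReal.ofReal (pairTime α (σ a - i) (σ b - i)) :=
    Equiv.sum_comp (Equiv.inv (Equiv.Perm (ZMod N)))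
      fun σ => ENNReal.ofReal (pairTime α (σ a - i) (σ b - i))
  rw [h2, h1, mul_comm, ENNReal.mul_div_cancel_right (by exact_mod_cast N.factorial_ne_zero)
    (ENNReal.natCast_ne_top _)]

theorem placementMeanTime_le [NeZero N] {α Δ : ℝ} (hα0 : 0 < α) (hα1 : α < 1) (hΔ : 0 < Δ)
    (hN : 2 ≤ N) {L : ℕ} (i : ZMod N) {q : ZMod N → ℝ} (hq : q ∈ unsettled N Δ L) :
    placementMeanTime α Δ L i q ≤ ENNReal.ofReal (closedForm N α) := by
  obtain ⟨z, a, b, rfl, ha, hb, hb0, haL, hab⟩ := exists_slots_of_mem_unsettled hΔ hq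
  have hne : a ≠ b := by
    rintro rfl
    omega
  rw [placementMeanTime, ← perm_average_pairTime hN hα0 hα1 i hne]
  gcongr with σ
  refine meanTime_scaled_le (z := z ∘ σ) hα0 hα1 hΔ hN i ?_ ?_ ?_ ?_ ?_ <;> simp [*]

theorem placementMeanTime_twoOutlier [NeZero N] {α Δ : ℝ} (hα0 : 0 < α) (hα1 : α < 1)
    (hΔ : 0 < Δ) (hN : 2 ≤ N) {ell : ℕ} (hell : 2 ≤ ell) (i : ZMod N) {a b : ZMod N}
    (hab : a ≠ b) :
    placementMeanTime α Δ (ell * N) i (twoOutlier Δ ell a b) =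
      ENNReal.ofReal (closedForm N α) := by
  rw [placementMeanTime, ← perm_average_pairTime hN hα0 hα1 i hab]
  congr 1
  refine Finset.sum_congr rfl fun σ _ => ?_
  have h : twoOutlier Δ ell a b ∘ σ = twoOutlier Δ ell (σ.symm a) (σ.symm b) := by
    rw [twoOutlier_eq_scaled, twoOutlier_eq_scaled, ← outlierSlots_comp]
    rfl
  rw [h, meanTime_twoOutlier hα0 hα1 hΔ hN (by omega) (add_two_le_mul hN hell) i
    (by simpa using hab)]

theorem twoOutlierMeanTime_eq [NeZero N] {α Δ : ℝ} (hα0 : 0 < α) (hα1 : α < 1)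
    (hΔ : 0 < Δ) (hN : 2 ≤ N) {ell : ℕ} (hell : 2 ≤ ell) (i : ZMod N) :
    twoOutlierMeanTime N α Δ ell i = ENNReal.ofReal (closedForm N α) := by
  have h : ∀ a b : ZMod N,
      (if a ≠ b then meanTime α Δ (ell * N) i (twoOutlier Δ ell a b) else 0) =
        if a ≠ b then ENNReal.ofReal (pairTime α (a - i) (b - i)) else 0 := by
    intro a b
    split_ifs with hab
    · exact meanTime_twoOutlier hα0 hα1 hΔ hN (by omega) (add_two_le_mul hN hell) i hab
    · rfl
  simp only [twoOutlierMeanTime, h]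
  rw [sum_ofReal_pairTime hN hα0 hα1, mul_comm,
    ENNReal.mul_div_cancel_right (natCast_mul_pred_ne_zero hN) (ENNReal.natCast_ne_top _)]

theorem maxMeanTime_le [NeZero N] {α Δ : ℝ} (hα0 : 0 < α) (hα1 : α < 1) (hΔ : 0 < Δ)
    (hN : 2 ≤ N) (L : ℕ) (i : ZMod N) {c : ℝ}
    (hc : ∀ a b : ZMod N, a ≠ b → pairTime α (a - i) (b - i) ≤ c) :
    maxMeanTime N α Δ L i ≤ ENNReal.ofReal c := by
  refine iSup₂_le fun q hq => ?_
  obtain ⟨z, a, b, rfl, ha, hb, hb0, haL, hab⟩ := exists_slots_of_mem_unsettled hΔ hq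
  refine (meanTime_scaled_le hα0 hα1 hΔ hN i ha hb hb0 haL hab).trans
    (ENNReal.ofReal_le_ofReal (hc a b ?_))
  rintro rfl
  omega

theorem exists_maximal_pairTime [NeZero N] (hN : 2 ≤ N) (α : ℝ) (i : ZMod N) :
    ∃ a b : ZMod N, a ≠ b ∧
      ∀ x y : ZMod N, x ≠ y → pairTime α (x - i) (y - i) ≤ pairTime α (a - i) (b - i) := by
  have hne : (Finset.univ.filter fun s : ZMod N × ZMod N => s.1 ≠ s.2).Nonempty :=
    ⟨(i, i + 1), by simpa using ne_add_one hN i⟩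
  obtain ⟨⟨a, b⟩, hab, hmax⟩ := Finset.exists_max_image _
    (fun s : ZMod N × ZMod N => pairTime α (s.1 - i) (s.2 - i)) hne
  refine ⟨a, b, (Finset.mem_filter.1 hab).2, fun x y hxy => ?_⟩
  exact hmax (x, y) (Finset.mem_filter.2 ⟨Finset.mem_univ _, hxy⟩)

/-- The largest `pairTime` bounds every state for every `L`, and placing the outliers at a
maximising pair attains it. -/
theorem exists_maxMeanTime_eq [NeZero N] {α Δ : ℝ} (hα0 : 0 < α) (hα1 : α < 1)
    (hΔ : 0 < Δ) (hN : 2 ≤ N) {ell : ℕ} (hell : 2 ≤ ell) (i : ZMod N) :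
    ∃ a b : ZMod N, a ≠ b ∧ twoOutlier Δ ell a b ∈ unsettled N Δ (ell * N) ∧
      maxMeanTime N α Δ (ell * N) i = meanTime α Δ (ell * N) i (twoOutlier Δ ell a b) ∧
      ∀ L, maxMeanTime N α Δ L i ≤ maxMeanTime N α Δ (ell * N) i := by
  obtain ⟨a, b, hab, hmax⟩ := exists_maximal_pairTime hN α i
  have hmem := twoOutlier_mem_unsettled hΔ hN hell hab
  have hle : ∀ L, maxMeanTime N α Δ L i ≤ meanTime α Δ (ell * N) i (twoOutlier Δ ell a b) := by
    intro L
    rw [meanTime_twoOutlier hα0 hα1 hΔ hN (by omega) (add_two_le_mul hN hell) i hab]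
    exact maxMeanTime_le hα0 hα1 hΔ hN L i hmax
  have hge : meanTime α Δ (ell * N) i (twoOutlier Δ ell a b) ≤ maxMeanTime N α Δ (ell * N) i :=
    le_iSup₂ (f := fun q (_ : q ∈ unsettled N Δ (ell * N)) => meanTime α Δ (ell * N) i q) _ hmem
  exact ⟨a, b, hab, hmem, (hle _).antisymm hge, fun L => (hle L).trans hge⟩

end Main

/-! ### Asymptotics and conclusion -/

theorem closedForm_isEquivalent {α : ℝ} (hα0 : 0 < α) (hα1 : α < 1) :
    (fun N : ℕ => closedForm N α) ~[atTop] fun N : ℕ => gConst α * (N : ℝ) ^ 3 := by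
  have h1 : 1 - α ≠ 0 := by linarith
  have h2 : 1 + α ≠ 0 := by linarith
  have h2' : α + 1 ≠ 0 := by linarith
  have hg : gConst α ≠ 0 := by
    rw [gConst]
    exact div_ne_zero h2' (by simpa using h1)
  refine isEquivalent_of_tendsto_one ?_
  have hinv : Tendsto (fun N : ℕ => ((N : ℝ))⁻¹) atTop (nhds 0) := tendsto_inv_atTop_nhds_zero_nat
  -- This polynomial in `1 / N` is the quotient of the two sides.
  have hlim : Tendsto (fun N : ℕ => 1 + (N : ℝ)⁻¹ +
      12 * (α - 1) ^ 2 / (α + 1) ^ 2 * (N : ℝ)⁻¹ ^ 2 -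
      24 * (α - 1) * (2 * α - 1) / (α + 1) ^ 2 * (N : ℝ)⁻¹ ^ 3 +
      24 * (α - 1) ^ 2 / (α + 1) ^ 2 * (N : ℝ)⁻¹ ^ 4) atTop
      (nhds (1 + 0 + 12 * (α - 1) ^ 2 / (α + 1) ^ 2 * 0 ^ 2 -
      24 * (α - 1) * (2 * α - 1) / (α + 1) ^ 2 * 0 ^ 3 +
      24 * (α - 1) ^ 2 / (α + 1) ^ 2 * 0 ^ 4)) :=
    (((tendsto_const_nhds.add hinv).add ((hinv.pow 2).const_mul _)).sub
      ((hinv.pow 3).const_mul _)).add ((hinv.pow 4).const_mul _)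
  norm_num at hlim
  refine hlim.congr' ?_
  filter_upwards [eventually_gt_atTop 0] with N hN
  have hN' : (N : ℝ) ≠ 0 := by exact_mod_cast hN.ne'
  simp only [Pi.div_apply, closedForm, gConst]
  field_simp
  ring

end DitheredDesync

theorem theorem3 :
    -- exact value in the worst case
    (∀ (N : ℕ) [NeZero N], 2 ≤ N → ∀ α Δ : ℝ, 0 < α → α < 1 → 0 < Δ → ∀ (ell : ℕ), 2 ≤ ell →
      ∀ i : ZMod N,
        DitheredDesync.twoOutlierMeanTime N α Δ ell i =
            ENNReal.ofReal (DitheredDesync.closedForm N α) ∧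
        IsGreatest
            (DitheredDesync.placementMeanTime α Δ (ell * N) i ''
              DitheredDesync.unsettled N Δ (ell * N))
            (ENNReal.ofReal (DitheredDesync.closedForm N α)) ∧
        ∃ a b : ZMod N, a ≠ b ∧
          DitheredDesync.twoOutlier Δ ell a b ∈ DitheredDesync.unsettled N Δ (ell * N) ∧
          DitheredDesync.maxMeanTime N α Δ (ell * N) i =
            DitheredDesync.meanTime α Δ (ell * N) i (DitheredDesync.twoOutlier Δ ell a b)) ∧
    -- every other frame length takes at most as long
    (∀ (N : ℕ) [NeZero N], 2 ≤ N → ∀ α Δ : ℝ, 0 < α → α < 1 → 0 < Δ → ∀ (L : ℕ) (i : ZMod N),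
        (∀ q ∈ DitheredDesync.unsettled N Δ L,
          DitheredDesync.placementMeanTime α Δ L i q ≤
            ENNReal.ofReal (DitheredDesync.closedForm N α)) ∧
        ∀ ell : ℕ, 2 ≤ ell →
          DitheredDesync.maxMeanTime N α Δ L i ≤ DitheredDesync.maxMeanTime N α Δ (ell * N) i) ∧
    -- growth, with an absolute implied constant
    (∃ C : ℝ, 0 < C ∧ ∀ (N : ℕ) [NeZero N], 2 ≤ N → ∀ α Δ : ℝ, 0 < α → α < 1 → 0 < Δ →
      ∀ (L : ℕ) (i : ZMod N),
        DitheredDesync.maxMeanTime N α Δ L i ≤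
          ENNReal.ofReal (C * (DitheredDesync.gConst α * (N : ℝ) ^ 3))) ∧
    (∀ α : ℝ, 0 < α → α < 1 →
      (fun N : ℕ => DitheredDesync.closedForm N α) ~[atTop]
        fun N : ℕ => DitheredDesync.gConst α * (N : ℝ) ^ 3) := by
  refine ⟨fun N _ hN α Δ hα0 hα1 hΔ ell hell i => ?_, fun N _ hN α Δ hα0 hα1 hΔ L i => ?_,
    ⟨30, by norm_num, fun N _ hN α Δ hα0 hα1 hΔ L i => ?_⟩,
    fun α hα0 hα1 => DitheredDesync.closedForm_isEquivalent hα0 hα1⟩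
  · refine ⟨DitheredDesync.twoOutlierMeanTime_eq hα0 hα1 hΔ hN hell i, ⟨?_, ?_⟩, ?_⟩
    · have hne := DitheredDesync.ne_add_one hN i
      exact ⟨_, DitheredDesync.twoOutlier_mem_unsettled hΔ hN hell hne,
        DitheredDesync.placementMeanTime_twoOutlier hα0 hα1 hΔ hN hell i hne⟩
    · rintro _ ⟨q, hq, rfl⟩
      exact DitheredDesync.placementMeanTime_le hα0 hα1 hΔ hN i hq
    · obtain ⟨a, b, hab, hmem, hmax, -⟩ :=
        DitheredDesync.exists_maxMeanTime_eq hα0 hα1 hΔ hN hell i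
      exact ⟨a, b, hab, hmem, hmax⟩
  · refine ⟨fun q hq => DitheredDesync.placementMeanTime_le hα0 hα1 hΔ hN i hq,
      fun ell hell => ?_⟩
    obtain ⟨a, b, -, -, -, hle⟩ := DitheredDesync.exists_maxMeanTime_eq hα0 hα1 hΔ hN hell i
    exact hle L
  · exact DitheredDesync.maxMeanTime_le hα0 hα1 hΔ hN L i fun a b hab =>
      DitheredDesync.pairTime_le hN hα0 hα1 (by simpa using hab)
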